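/- A school matching instance consists of a finite set $A$ of students and a finite set $B$ of schools, a strict linear order $\succ_a$ on $B^+=B\cup\{\emptyset\}$ for every $a\in A$, a strict linear order $\succ_b$ on $A^+=A\cup\{\emptyset\}$ for every $b\in B$ (where $\emptyset$ is the outside option), and a quota $q_b\in\{0,1,\dots,|A|\}$ for every $b\in B$. A matching $M$ assigns to each student $a$ an element $M(a)\in B^+$ such that at most $q_b$ students are assigned to each school $b$; $M(b)\subseteq A^+$ denotes the set of students assigned to $b$, together with $\emptyset$ if these are fewer than $q_b$. The matching $M$ is stable if (i) there are no $a\in A$, $b\in B$ with $b\succ_a M(a)$ and $a\succ_b x$ for some $x\in M(b)$; (ii) no student $a$ has $\emptyset\succ_a M(a)$; and (iii) no school $b$ has $\emptyset\succ_b a$ for some student $a\in M(b)$. A sibling instance is a school matching instance together with a finite set $\mathcal C\subseteq A\times A$ of pairs of distinct students. A pair $(a,\bar a)\in\mathcal C$ is matched to the same school by $M$ if $M(a)=M(\bar a)=b$ for some school $b\in B$. Theorem. The following two problems, whose input is a sibling instance (given by the quotas, the preference lists and the list of sibling pairs), can be solved in polynomial time, i.e. by a random access machine whose number of steps is bounded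 by a polynomial in the length of the input. (1) (MSSS) Find a stable matching that matches every sibling pair in $\mathcal C$ to the same school, or report that no such stable matching exists. (In particular, one can decide in polynomial time whether such a stable matching exists.) (2) Find a stable matching that maximizes, among all stable matchings, the number of pairs in $\mathcal C$ that are matched to the same school. -/

import Mathlib

/-! ### School matching instances, matchings and stability -/

/-- A school matching instance with `n` students and `m` schools.  `Option (Fin m)` is the set of
schools together with the outside option `none`; `Option (Fin n)` is the set of students together
with the outside option `none`.  A strict linear order over one of these finite sets is given as a
preference list: `studentPref a i` is the alternative that student `a` ranks in position `i`
(position `0` is the most preferred), and similarly for schools. -/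
structure SchoolInstance (n m : ℕ) where
  studentPref : Fin n → Fin (m + 1) ≃ Option (Fin m)
  schoolPref : Fin m → Fin (n + 1) ≃ Option (Fin n)
  quota : Fin m → ℕ
  quota_le : ∀ b, quota b ≤ n

namespace SchoolInstance

variable {n m : ℕ} (I : SchoolInstance n m)

/-- Student `a` strictly prefers `x` to `y`. -/
def StudentPrefers (a : Fin n) (x y : Option (Fin m)) : Prop :=
  (I.studentPref a).symm x < (I.studentPref a).symm y

/-- School `b` strictly prefers `x` to `y`. -/
def SchoolPrefers (b : Fin m) (x y : Option (Fin n)) : Prop :=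
  (I.schoolPref b).symm x < (I.schoolPref b).symm y

/-- An assignment of every student to a school or to the outside option is a matching if no school
exceeds its quota. -/
def IsMatching (M : Fin n → Option (Fin m)) : Prop :=
  ∀ b, (Finset.univ.filter fun a => M a = some b).card ≤ I.quota b

/-- `x` is a partner of the school `b` in `M`: the students assigned to `b` and, if fewer than
`quota b` students are assigned to `b`, also the outside option. -/
def IsPartner (M : Fin n → Option (Fin m)) (b : Fin m) : Option (Fin n) → Prop
  | some a => M a = some b
  | none => (Finset.univ.filter fun a => M a = some b).card < I.quota b

/-- A matching is stable if there are no blocking pairs, no blocking students and no blocking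
schools. -/
structure IsStable (M : Fin n → Option (Fin m)) : Prop where
  isMatching : I.IsMatching M
  no_blocking_pair : ∀ a b, ¬ (I.StudentPrefers a (some b) (M a) ∧
    ∃ x, I.IsPartner M b x ∧ I.SchoolPrefers b (some a) x)
  no_blocking_student : ∀ a, ¬ I.StudentPrefers a none (M a)
  no_blocking_school : ∀ b, ¬ ∃ a, M a = some b ∧ I.SchoolPrefers b none (some a)

end SchoolInstance

/-- A sibling instance: a school matching instance together with a finite set of pairs of distinct
students, given as a list without repetitions. -/
structure SiblingInstance where
  n : ℕ
  m : ℕ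
  inst : SchoolInstance n m
  siblings : List (Fin n × Fin n)
  siblings_nodup : siblings.Nodup
  siblings_ne : ∀ p ∈ siblings, p.1 ≠ p.2

namespace SiblingInstance

variable (X : SiblingInstance)

/-- The two students of the pair `p` are assigned by `M` to the same school (the outside option is
not a school). -/
def SameSchool (M : Fin X.n → Option (Fin X.m)) (p : Fin X.n × Fin X.n) : Prop :=
  ∃ b, M p.1 = some b ∧ M p.2 = some b

open Classical in
/-- The number of sibling pairs that `M` assigns to the same school. -/
noncomputable def numTogether (M : Fin X.n → Option (Fin X.m)) : ℕ :=
  (X.siblings.filter fun p => X.SameSchool M p).length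

/-- A correct answer to (MSSS): a stable matching that assigns every sibling pair to the same
school, or `none` if there is no such matching. -/
def IsSameSchoolAnswer : Option (Fin X.n → Option (Fin X.m)) → Prop
  | some M => X.inst.IsStable M ∧ ∀ p ∈ X.siblings, X.SameSchool M p
  | none => ¬ ∃ M, X.inst.IsStable M ∧ ∀ p ∈ X.siblings, X.SameSchool M p

/-- `M` is a stable matching that assigns as many sibling pairs as possible to the same school. -/
def IsMaxTogether (M : Fin X.n → Option (Fin X.m)) : Prop :=
  X.inst.IsStable M ∧ ∀ M', X.inst.IsStable M' → X.numTogether M' ≤ X.numTogether M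

/-! ### Encodings by lists of natural numbers -/

/-- The number that encodes an agent or the outside option. -/
def code {k : ℕ} : Option (Fin k) → ℕ
  | none => 0
  | some i => i.val + 1

/-- The input: the numbers of students, of schools and of sibling pairs, the quotas, the preference
lists of the students, the preference lists of the schools, and the sibling pairs. -/
def encode : List ℕ :=
  [X.n, X.m, X.siblings.length]
    ++ List.ofFn X.inst.quota
    ++ (List.ofFn fun a => List.ofFn fun i => code (X.inst.studentPref a i)).flatten
    ++ (List.ofFn fun b => List.ofFn fun i => code (X.inst.schoolPref b i)).flatten
    ++ (X.siblings.map fun p => [code (some p.1), code (some p.2)]).flatten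

/-- A matching is written down as the list of the partners of the students. -/
def encodeMatching (M : Fin X.n → Option (Fin X.m)) : List ℕ :=
  List.ofFn fun a => code (M a)

/-- An optional matching: `0` for "there is none", or `1` followed by the matching. -/
def encodeAnswer : Option (Fin X.n → Option (Fin X.m)) → List ℕ
  | none => [0]
  | some M => 1 :: X.encodeMatching M

end SiblingInstance

/-! ### Random access machine programs with a step count

Programs of a random access machine with addition, truncated subtraction, indirect addressing
(arrays), conditionals and loops.  Every elementary operation costs one unit of time.  There is no
multiplication, so the lengths of the numbers in use grow by at most one bit per time unit; hence
polynomial time on this machine is the usual polynomial time. -/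

namespace RAM

/-- A memory: the values of the scalar variables and of the cells of the arrays. -/
structure State where
  var : ℕ → ℕ
  arr : ℕ → ℕ → ℕ

/-- Expressions: constants, variables, array cells `k[e]`, sums, and truncated differences. -/
inductive Expr where
  | const (c : ℕ)
  | var (x : ℕ)
  | read (k : ℕ) (e : Expr)
  | add (e₁ e₂ : Expr)
  | sub (e₁ e₂ : Expr)

namespace Expr

def eval (s : State) : Expr → ℕ
  | const c => c
  | var x => s.var x
  | read k e => s.arr k (e.eval s)
  | add e₁ e₂ => e₁.eval s + e₂.eval s
  | sub e₁ e₂ => e₁.eval s - e₂.eval s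

/-- The number of elementary operations in the evaluation of an expression. -/
def cost : Expr → ℕ
  | const _ => 1
  | var _ => 1
  | read _ e => e.cost + 1
  | add e₁ e₂ => e₁.cost + e₂.cost + 1
  | sub e₁ e₂ => e₁.cost + e₂.cost + 1

end Expr

/-- Programs.  In tests, a nonzero value counts as true. -/
inductive Prog where
  | skip
  | assign (x : ℕ) (e : Expr)
  | write (k : ℕ) (i e : Expr)
  | seq (c₁ c₂ : Prog)
  | ite (e : Expr) (c₁ c₂ : Prog)
  | loop (e : Expr) (c : Prog)

/-- `x := v`. -/
def State.setVar (s : State) (x v : ℕ) : State :=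
  { s with var := Function.update s.var x v }

/-- `k[i] := v`. -/
def State.setArr (s : State) (k i v : ℕ) : State :=
  { s with arr := Function.update s.arr k (Function.update (s.arr k) i v) }

/-- `Exec c s s' t`: started in the memory `s`, the program `c` halts in the memory `s'` after
exactly `t` steps. -/
inductive Exec : Prog → State → State → ℕ → Prop where
  | skip (s : State) : Exec Prog.skip s s 1
  | assign (s : State) (x : ℕ) (e : Expr) :
      Exec (Prog.assign x e) s (s.setVar x (e.eval s)) (e.cost + 1)
  | write (s : State) (k : ℕ) (i e : Expr) :
      Exec (Prog.write k i e) s (s.setArr k (i.eval s) (e.eval s)) (i.cost + e.cost + 1)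
  | seq {c₁ c₂ : Prog} {s₁ s₂ s₃ : State} {t₁ t₂ : ℕ} :
      Exec c₁ s₁ s₂ t₁ → Exec c₂ s₂ s₃ t₂ → Exec (Prog.seq c₁ c₂) s₁ s₃ (t₁ + t₂)
  | ite_true {e : Expr} {c₁ c₂ : Prog} {s s' : State} {t : ℕ} :
      e.eval s ≠ 0 → Exec c₁ s s' t → Exec (Prog.ite e c₁ c₂) s s' (e.cost + 1 + t)
  | ite_false {e : Expr} {c₁ c₂ : Prog} {s s' : State} {t : ℕ} :
      e.eval s = 0 → Exec c₂ s s' t → Exec (Prog.ite e c₁ c₂) s s' (e.cost + 1 + t)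
  | loop_true {e : Expr} {c : Prog} {s₁ s₂ s₃ : State} {t₁ t₂ : ℕ} :
      e.eval s₁ ≠ 0 → Exec c s₁ s₂ t₁ → Exec (Prog.loop e c) s₂ s₃ t₂ →
      Exec (Prog.loop e c) s₁ s₃ (e.cost + 1 + t₁ + t₂)
  | loop_false {e : Expr} {c : Prog} {s : State} :
      e.eval s = 0 → Exec (Prog.loop e c) s s (e.cost + 1)

/-- The initial memory on input `l`: array `0` holds the input, variable `0` holds its number of
entries, and everything else is `0`. -/
def init (l : List ℕ) : State where
  var := fun x => if x = 0 then l.length else 0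
  arr := fun k i => if k = 0 then l.getD i 0 else 0

/-- The output in a final memory: the first entries of array `1`, as many as variable `1` says. -/
def output (s : State) : List ℕ :=
  (List.range (s.var 1)).map (s.arr 1)

/-- The size of an input: the total binary length of its entries, plus one separator each. -/
def inputSize (l : List ℕ) : ℕ :=
  (l.map fun v => Nat.size v + 1).sum

/-- The computational problem that asks, for the input `enc x`, for some output list `y` with
`R x y`, is solvable in polynomial time: one program, with running time bounded by one polynomial in
the size of the input, halts with a correct output on every input. -/
def SolvableInPolyTime {α : Type} (enc : α → List ℕ) (R : α → List ℕ → Prop) : Prop :=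
  ∃ (c : Prog) (p : Polynomial ℕ), ∀ x : α, ∃ (s : State) (t : ℕ),
    Exec c (init (enc x)) s t ∧ t ≤ p.eval (inputSize (enc x)) ∧ R x (output s)

end RAM

/-
Record a matching by the position that each student takes in the own preference list. A position
vector is *settled* if no school that has been reached rejects the student at it, and *justified* if
every school passed over rejects the student who passed it. Rejections are monotone in the position
vector, so settled vectors are closed under `⊓` and justified ones under `⊔`. The vectors of stable
matchings are those with both properties, they are closed under `⊔`, and carrying out rejections
from any vector leads to the least stable vector above it (deferred acceptance).

Consider the *events* "the pair `p` is together at the school `b`" that happen in some stable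
matching. If `b` prefers the student `v` to `w`, then in a stable matching `w` never leaves `b`
before `v` gets there, so for a stable vector `q` the indicator of the event is
`[q has reached b for both students] + [q has not passed b for w] - 1`.
Hence the number of events that happen is, up to a constant, the number of lower bounds plus the
number of upper bounds that `q` satisfies. A lower and an upper bound conflict if no stable vector
satisfies both, and conflict-free bounds are satisfied together by the join of the least stable
vectors above the lower bounds. So the best value is the size of a maximum independent set in a
bipartite graph. An auction between lower and upper bounds finds it: an idle lower bound keeps
bidding on a cheapest conflicting upper bound, and once no one bids any more, each gap between the
prices separates the two sides of a maximum independent set.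

A stable matching that puts all pairs together exists if and only if a stable matching with the
maximum number of pairs together puts all pairs together.
-/

/-! ### Stable matchings as vectors of positions -/

open Finset in
/-- The numbers of smaller elements of the members of `S` are `0, …, #S - 1`. -/
theorem card_filter_card_filter_lt {α β : Type*} [LinearOrder β] (S : Finset α) (r : α → β)
    (hr : Set.InjOn r S) (k : ℕ) : #{a ∈ S | #{c ∈ S | r c < r a} < k} = min k #S := by
  classical
  induction S using Finset.induction_on_max_value r with
  | empty => simp
  | insert a S haS hmax ih =>
    have hlt : ∀ c ∈ S, r c < r a := fun c hc => (hmax c hc).lt_of_ne fun h =>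
      haS (hr (by simp [hc]) (by simp) h ▸ hc)
    have below_max : #{c ∈ insert a S | r c < r a} = #S := by
      rw [filter_insert, if_neg (lt_irrefl _), filter_true_of_mem hlt]
    have below_mem : ∀ c ∈ S, {d ∈ insert a S | r d < r c} = {d ∈ S | r d < r c} := fun c hc => by
      rw [filter_insert, if_neg (hlt c hc).not_gt]
    have ih := ih (hr.mono (by simp))
    rw [← filter_congr fun c hc => by rw [← below_mem c hc]] at ih
    rw [filter_insert, below_max, card_insert_of_notMem haS]
    split_ifs with h
    · rw [card_insert_of_notMem (by simp [haS]), ih]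
      lia
    · rw [ih]
      lia

namespace SchoolInstance

section Positions

variable {n m : ℕ} (I : SchoolInstance n m)

/-- The position of the alternative `x` in the preference list of student `a`. -/
def pos (a : Fin n) (x : Option (Fin m)) : ℕ := (I.studentPref a).symm x

/-- The position of the alternative `x` in the preference list of school `b`. -/
def rank (b : Fin m) (x : Option (Fin n)) : ℕ := (I.schoolPref b).symm x

theorem pos_injective (a : Fin n) : Function.Injective (I.pos a) :=
  Fin.val_injective.comp (I.studentPref a).symm.injective

theorem rank_injective (b : Fin m) : Function.Injective (I.rank b) :=
  Fin.val_injective.comp (I.schoolPref b).symm.injective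

theorem pos_some_ne_pos_none (a : Fin n) (b : Fin m) : I.pos a (some b) ≠ I.pos a none :=
  (I.pos_injective a).ne (Option.some_ne_none b)

theorem rank_some_ne_rank_none (b : Fin m) (a : Fin n) : I.rank b (some a) ≠ I.rank b none :=
  (I.rank_injective b).ne (Option.some_ne_none a)

theorem pos_le (a : Fin n) (x : Option (Fin m)) : I.pos a x ≤ m :=
  Nat.lt_succ_iff.1 ((I.studentPref a).symm x).isLt

theorem studentPref_eq_iff {a : Fin n} {i : Fin (m + 1)} {x : Option (Fin m)} :
    I.studentPref a i = x ↔ I.pos a x = i := by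
  rw [← Equiv.eq_symm_apply, Fin.ext_iff, eq_comm, pos]

theorem exists_pos_eq (a : Fin n) {r : ℕ} (hr : r ≤ m) : ∃ x, I.pos a x = r :=
  ⟨I.studentPref a ⟨r, Nat.lt_succ_of_le hr⟩, I.studentPref_eq_iff.1 rfl⟩

theorem exists_pos_some_eq (a : Fin n) {r : ℕ} (hr : r < I.pos a none) :
    ∃ b, I.pos a (some b) = r := by
  obtain ⟨_ | b, hx⟩ := I.exists_pos_eq a (hr.le.trans (I.pos_le a none))
  · exact absurd hx hr.ne'
  · exact ⟨b, hx⟩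

/-- The students that have reached the school `b` in the position vector `q` and that `b` prefers to
the student `a`. -/
def rivals (q : Fin n → ℕ) (b : Fin m) (a : Fin n) : Finset (Fin n) :=
  {c | I.pos c (some b) ≤ q c ∧ I.rank b (some c) < I.rank b (some a)}

/-- School `b` rejects student `a` if `a` is not acceptable or if sufficiently many better students
have reached `b`. -/
def Rejects (q : Fin n → ℕ) (b : Fin m) (a : Fin n) : Prop :=
  I.rank b none < I.rank b (some a) ∨ I.quota b ≤ (I.rivals q b a).card

instance (q : Fin n → ℕ) (b : Fin m) (a : Fin n) : Decidable (I.Rejects q b a) :=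
  inferInstanceAs (Decidable (_ ∨ _))

/-- The `r`-th alternative of student `a` is a school that `a` accepts but that rejects `a`. -/
def RejectsAt (q : Fin n → ℕ) (a : Fin n) (r : ℕ) : Prop :=
  r < I.pos a none ∧ ∃ b, I.pos a (some b) = r ∧ I.Rejects q b a

/-- No student is rejected at the current position. -/
def IsSettled (q : Fin n → ℕ) : Prop :=
  ∀ a, ¬ I.RejectsAt q a (q a)

/-- Every student is rejected at all positions before the current one. -/
def IsJustified (q : Fin n → ℕ) : Prop :=
  ∀ a, ∀ r < q a, I.RejectsAt q a r

/-- The position vectors of stable matchings. -/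
structure IsStablePos (q : Fin n → ℕ) : Prop where
  isSettled : I.IsSettled q
  isJustified : I.IsJustified q

/-- The students that have reached the school `b` and are not rejected by it. -/
def held (q : Fin n → ℕ) (b : Fin m) : Finset (Fin n) :=
  {a | I.pos a (some b) ≤ q a ∧ ¬ I.Rejects q b a}

/-- The acceptable students that have reached the school `b`. -/
def applicants (q : Fin n → ℕ) (b : Fin m) : Finset (Fin n) :=
  {a | I.pos a (some b) ≤ q a ∧ I.rank b (some a) < I.rank b none}

/-- The students whose current position is the school `b`, which they accept. -/
def located (q : Fin n → ℕ) (b : Fin m) : Finset (Fin n) :=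
  {a | I.pos a (some b) = q a ∧ q a < I.pos a none}

end Positions

section Lattice

variable {n m : ℕ} {I : SchoolInstance n m} {p q q' l r : Fin n → ℕ} {a a' v w : Fin n} {b : Fin m}

theorem mem_rivals {c : Fin n} :
    c ∈ I.rivals q b a ↔ I.pos c (some b) ≤ q c ∧ I.rank b (some c) < I.rank b (some a) := by
  simp [rivals]

theorem mem_held : a ∈ I.held q b ↔ I.pos a (some b) ≤ q a ∧ ¬ I.Rejects q b a := by
  simp [held]

theorem mem_applicants :
    a ∈ I.applicants q b ↔ I.pos a (some b) ≤ q a ∧ I.rank b (some a) < I.rank b none := by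
  simp [applicants]

theorem mem_located : a ∈ I.located q b ↔ I.pos a (some b) = q a ∧ q a < I.pos a none := by
  simp [located]

theorem rejectsAt_pos :
    I.RejectsAt q a (I.pos a (some b)) ↔ I.pos a (some b) < I.pos a none ∧ I.Rejects q b a := by
  refine and_congr_right fun _ => ⟨?_, fun h => ⟨b, rfl, h⟩⟩
  rintro ⟨c, hc, h⟩
  rwa [Option.some_injective _ (I.pos_injective a hc)] at h

theorem Rejects.mono (h : q ≤ q') (hr : I.Rejects q b a) : I.Rejects q' b a := by
  refine hr.imp id fun hr => hr.trans (Finset.card_le_card fun c hc => ?_)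
  rw [mem_rivals] at hc ⊢
  exact ⟨hc.1.trans (h c), hc.2⟩

theorem RejectsAt.mono (h : q ≤ q') {i : ℕ} (hr : I.RejectsAt q a i) : I.RejectsAt q' a i :=
  ⟨hr.1, hr.2.imp fun _ hb => ⟨hb.1, hb.2.mono h⟩⟩

theorem RejectsAt.lt_of_le (hr : I.RejectsAt q a (q a)) (hp : I.IsSettled p) (h : q ≤ p) :
    q a < p a :=
  (h a).lt_of_ne fun heq => hp a (heq ▸ hr.mono h)

theorem Rejects.of_rank_le (hr : I.Rejects q b a)
    (h : I.rank b (some a) ≤ I.rank b (some a')) : I.Rejects q b a' := by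
  refine hr.imp (fun h' => h'.trans_le h) fun hr => hr.trans (Finset.card_le_card fun c hc => ?_)
  rw [mem_rivals] at hc ⊢
  exact ⟨hc.1, hc.2.trans_le h⟩

theorem IsJustified.le_pos_none (h : I.IsJustified q) (a : Fin n) : q a ≤ I.pos a none :=
  not_lt.1 fun hlt => (h a _ hlt).1.false

theorem IsJustified.rejects (h : I.IsJustified q) (hlt : I.pos a (some b) < q a) :
    I.Rejects q b a :=
  (rejectsAt_pos.1 (h a _ hlt)).2

theorem IsJustified.lt_pos_none (h : I.IsJustified q) (hq : I.pos a (some b) = q a) :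
    q a < I.pos a none :=
  (h.le_pos_none a).lt_of_ne (hq ▸ I.pos_some_ne_pos_none a b)

theorem IsJustified.sup (hp : I.IsJustified p) (hq : I.IsJustified q) : I.IsJustified (p ⊔ q) :=
  fun a i hi => (lt_sup_iff.1 hi).elim (fun h => (hp a i h).mono le_sup_left)
    fun h => (hq a i h).mono le_sup_right

theorem IsSettled.inf (hp : I.IsSettled p) (hq : I.IsSettled q) : I.IsSettled (p ⊓ q) := by
  intro a hr
  rcases min_choice (p a) (q a) with h | h <;> rw [Pi.inf_apply, h] at hr
  · exact hp a (hr.mono inf_le_left)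
  · exact hq a (hr.mono inf_le_right)

open Finset in
theorem card_held (q : Fin n → ℕ) (b : Fin m) :
    #(I.held q b) = min (I.quota b) #(I.applicants q b) := by
  rw [← card_filter_card_filter_lt (I.applicants q b) (fun a => I.rank b (some a))
    ((I.rank_injective b).comp (Option.some_injective _)).injOn]
  congr 1
  ext a
  rw [mem_filter, mem_held, mem_applicants, Rejects, not_or, not_lt, not_le,
    (I.rank_some_ne_rank_none b a).le_iff_lt, and_assoc]
  refine and_congr_right fun _ => and_congr_right fun hacc => ?_
  have : {c ∈ I.applicants q b | I.rank b (some c) < I.rank b (some a)} = I.rivals q b a := by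
    ext c
    simp only [mem_filter, mem_applicants, mem_rivals, and_assoc]
    exact and_congr_right fun _ => and_iff_right_of_imp fun h => h.trans hacc
  rw [this]

theorem card_held_mono (h : q ≤ q') (b : Fin m) : (I.held q b).card ≤ (I.held q' b).card := by
  rw [card_held, card_held]
  refine min_le_min_left _ (Finset.card_le_card fun c hc => ?_)
  rw [mem_applicants] at hc ⊢
  exact ⟨hc.1.trans (h c), hc.2⟩

theorem Rejects.card_held_eq_quota (hr : I.Rejects q b a)
    (hacc : I.rank b (some a) < I.rank b none) : (I.held q b).card = I.quota b := by
  have hquota : I.quota b ≤ (I.rivals q b a).card := hr.resolve_left hacc.not_gt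
  rw [card_held, min_eq_left]
  refine hquota.trans (Finset.card_le_card fun c hc => ?_)
  rw [mem_rivals] at hc
  exact mem_applicants.2 ⟨hc.1, hc.2.trans hacc⟩

theorem IsSettled.located_subset_held (h : I.IsSettled q) (b : Fin m) :
    I.located q b ⊆ I.held q b := by
  intro a ha
  obtain ⟨hpos, hlt⟩ := mem_located.1 ha
  exact mem_held.2 ⟨hpos.le, fun hr => h a ⟨hlt, b, hpos, hr⟩⟩

theorem IsJustified.held_subset_located (h : I.IsJustified q) (b : Fin m) :
    I.held q b ⊆ I.located q b := by
  intro a ha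
  obtain ⟨hle, hr⟩ := mem_held.1 ha
  have hpos : I.pos a (some b) = q a := hle.antisymm (not_lt.1 fun hlt => hr (h.rejects hlt))
  exact mem_located.2 ⟨hpos, h.lt_pos_none hpos⟩

theorem IsStablePos.held_eq_located (h : I.IsStablePos q) (b : Fin m) :
    I.held q b = I.located q b :=
  (h.isJustified.held_subset_located b).antisymm (h.isSettled.located_subset_held b)

open Finset in
theorem sum_card_located (q : Fin n → ℕ) :
    ∑ b, #(I.located q b) = #{a | q a < I.pos a none} := by
  rw [← card_biUnion]
  · congr 1
    ext a
    simp only [mem_biUnion, mem_univ, true_and, mem_located, mem_filter, exists_and_right,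
      and_iff_right_iff_imp]
    exact I.exists_pos_some_eq a
  · intro b _ c _ hbc
    refine disjoint_left.2 fun a hb hc => hbc ?_
    exact Option.some_injective _
      (I.pos_injective a ((mem_located.1 hb).1.trans (mem_located.1 hc).1.symm))

theorem sum_card_located_anti (h : q ≤ q') :
    ∑ b, (I.located q' b).card ≤ ∑ b, (I.located q b).card := by
  rw [sum_card_located, sum_card_located]
  exact Finset.card_le_card (Finset.monotone_filter_right _ fun a _ ha => (h a).trans_lt ha)

/-- Moving the students up can only decrease the number of located students and increase the number
of held students. As `q` is justified, its held students are located, so all these numbers agree. -/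
theorem IsStablePos.of_ge (hp : I.IsStablePos p) (hpq : p ≤ q) (hq : I.IsJustified q) :
    I.IsStablePos q := by
  have hle : ∀ b ∈ Finset.univ, (I.held q b).card ≤ (I.located q b).card := fun b _ =>
    Finset.card_le_card (hq.held_subset_located b)
  have hge : ∑ b, (I.located q b).card ≤ ∑ b, (I.held q b).card :=
    (sum_card_located_anti hpq).trans (Finset.sum_le_sum fun b _ => by
      rw [← hp.held_eq_located b]; exact card_held_mono hpq b)
  have heq := (Finset.sum_eq_sum_iff_of_le hle).1 ((Finset.sum_le_sum hle).antisymm hge)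
  refine ⟨fun a => ?_, hq⟩
  rintro ⟨hlt, b, hb, hr⟩
  have : a ∈ I.held q b := Finset.eq_of_subset_of_card_le (hq.held_subset_located b)
    (heq b (Finset.mem_univ b)).ge ▸ mem_located.2 ⟨hb, hlt⟩
  exact (mem_held.1 this).2 hr

theorem IsStablePos.card_held_eq_of_le (hp : I.IsStablePos p) (hqp : q ≤ p) (hq : I.IsSettled q)
    (b : Fin m) :
    (I.located q b).card = (I.held q b).card ∧ (I.held q b).card = (I.held p b).card := by
  have hlh : ∀ b ∈ Finset.univ, (I.located q b).card ≤ (I.held q b).card := fun b _ =>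
    Finset.card_le_card (hq.located_subset_held b)
  have hhh : ∀ b ∈ Finset.univ, (I.held q b).card ≤ (I.held p b).card := fun b _ =>
    card_held_mono hqp b
  have hsum : ∑ b, (I.held p b).card ≤ ∑ b, (I.located q b).card := by
    simp only [hp.held_eq_located]
    exact sum_card_located_anti hqp
  have hlh_sum := Finset.sum_le_sum hlh
  have hhh_sum := Finset.sum_le_sum hhh
  exact ⟨(Finset.sum_eq_sum_iff_of_le hlh).1 (by lia) b (Finset.mem_univ b),
    (Finset.sum_eq_sum_iff_of_le hhh).1 (by lia) b (Finset.mem_univ b)⟩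

theorem IsStablePos.of_le (hp : I.IsStablePos p) (hqp : q ≤ p) (hq : I.IsSettled q) :
    I.IsStablePos q := by
  refine ⟨hq, fun a i hi => ?_⟩
  have hnone : i < I.pos a none := hi.trans_le ((hqp a).trans (hp.isJustified.le_pos_none a))
  obtain ⟨b, rfl⟩ := I.exists_pos_some_eq a hnone
  refine rejectsAt_pos.2 ⟨hnone, by_contra fun hr => ?_⟩
  have : a ∈ I.located q b := Finset.eq_of_subset_of_card_le (hq.located_subset_held b)
    (hp.card_held_eq_of_le hqp hq b).1.ge ▸ mem_held.2 ⟨hi.le, hr⟩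
  exact hi.ne (mem_located.1 this).1

theorem IsStablePos.sup (hp : I.IsStablePos p) (hq : I.IsStablePos q) : I.IsStablePos (p ⊔ q) :=
  hp.of_ge le_sup_left (hp.isJustified.sup hq.isJustified)

theorem IsStablePos.mem_held (h : I.IsStablePos q) (hb : I.pos a (some b) = q a) :
    a ∈ I.held q b :=
  h.held_eq_located b ▸ mem_located.2 ⟨hb, h.isJustified.lt_pos_none hb⟩

theorem IsStablePos.le (h : I.IsStablePos q) (a : Fin n) : q a ≤ m :=
  (h.isJustified.le_pos_none a).trans (I.pos_le a none)

theorem IsJustified.update (h : I.IsJustified q) (hr : I.RejectsAt q a (q a)) :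
    I.IsJustified (Function.update q a (q a + 1)) := by
  have hle : q ≤ Function.update q a (q a + 1) :=
    le_update_iff.2 ⟨Nat.le_succ _, fun _ _ => le_rfl⟩
  intro c i hi
  refine RejectsAt.mono hle ?_
  rcases eq_or_ne c a with rfl | hca
  · rw [Function.update_self] at hi
    rcases (Nat.lt_succ_iff.1 hi).lt_or_eq with h' | rfl
    exacts [h c i h', hr]
  · rw [Function.update_of_ne hca] at hi
    exact h c i hi

theorem exists_isStablePos (I : SchoolInstance n m) : ∃ q, I.IsStablePos q := by
  have hfin : {q | I.IsJustified q}.Finite := (Set.finite_Iic fun _ => m).subset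
    fun q (hq : I.IsJustified q) a => (hq.le_pos_none a).trans (I.pos_le a none)
  obtain ⟨q, hq⟩ := hfin.exists_maximal ⟨0, fun a i hi => absurd hi (Nat.not_lt_zero i)⟩
  refine ⟨q, fun a hr => ?_, hq.prop⟩
  have := hq.le_of_ge (hq.prop.update hr) (le_update_iff.2 ⟨Nat.le_succ _, fun _ _ => le_rfl⟩) a
  rw [Function.update_self] at this
  exact Nat.not_succ_le_self _ this

variable (I) in
/-- `q` may occur when rejections are carried out from `l` on: it lies above `l`, and below every
stable position vector above `l`. -/
structure IsReachable (l q : Fin n → ℕ) : Prop where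
  le : l ≤ q
  le_length : ∀ a, q a ≤ m
  le_of_le : ∀ p, I.IsStablePos p → l ≤ p → q ≤ p

theorem IsReachable.update (h : I.IsReachable l q) (hr : I.RejectsAt q a (q a)) :
    I.IsReachable l (Function.update q a (q a + 1)) where
  le := h.le.trans (le_update_self_iff.2 (Nat.le_succ _))
  le_length := (Function.forall_update_iff _ fun _ i => i ≤ m).2
    ⟨hr.1.trans_le (I.pos_le a none), fun b _ => h.le_length b⟩
  le_of_le p hp hlp := update_le_iff.2
    ⟨hr.lt_of_le hp.isSettled (h.le_of_le p hp hlp), fun b _ => h.le_of_le p hp hlp b⟩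

theorem IsReachable.isStablePos (h : I.IsReachable l q) (hq : I.IsSettled q) (hp : I.IsStablePos p)
    (hlp : l ≤ p) : I.IsStablePos q :=
  hp.of_le (h.le_of_le p hp hlp) hq

theorem IsStablePos.exists_pos_lt (hp : I.IsStablePos p) (hr : I.IsStablePos r)
    (hv : I.pos v (some b) = r v) (hpv : p v < I.pos v (some b)) :
    ∃ z, I.pos z (some b) = p z ∧ I.pos z (some b) < r z := by
  have hinf : I.IsSettled (p ⊓ r) := hp.isSettled.inf hr.isSettled
  have hv_held : v ∉ I.held (p ⊓ r) b := fun h =>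
    hpv.not_ge ((SchoolInstance.mem_held.1 h).1.trans inf_le_left)
  obtain ⟨z, hz, hzr⟩ : ∃ z ∈ I.held (p ⊓ r) b, z ∉ I.held r b := by
    by_contra! hsub
    exact hv_held (Finset.eq_of_subset_of_card_le hsub
      (hr.card_held_eq_of_le inf_le_right hinf b).2.ge ▸ hr.mem_held hv)
  have hz_inf : I.pos z (some b) = min (p z) (r z) := (mem_located.1
    ((hr.of_le inf_le_right hinf).isJustified.held_subset_located b hz)).1
  have hz_ne : I.pos z (some b) ≠ r z := fun h => hzr (hr.mem_held h)
  exact ⟨z, by lia, by lia⟩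

theorem IsStablePos.pos_le_of_pos_lt (hp : I.IsStablePos p) (hr : I.IsStablePos r)
    (hv : I.pos v (some b) = r v) (hw : I.pos w (some b) = r w) (hpw : I.pos w (some b) < p w) :
    I.pos v (some b) ≤ p v := by
  by_contra! hpv
  obtain ⟨z, hzp, hzr⟩ := hp.exists_pos_lt hr hv hpv
  have hz_notRejects : ¬ I.Rejects p b z := (SchoolInstance.mem_held.1 (hp.mem_held hzp)).2
  have hw_notRejects : ¬ I.Rejects r b w := (SchoolInstance.mem_held.1 (hr.mem_held hw)).2
  rcases le_total (I.rank b (some w)) (I.rank b (some z)) with h | h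
  · exact hz_notRejects ((hp.isJustified.rejects hpw).of_rank_le h)
  · exact hw_notRejects ((hr.isJustified.rejects hzr).of_rank_le h)

end Lattice

section Matchings

variable {n m : ℕ} {I : SchoolInstance n m} {q : Fin n → ℕ} {M : Fin n → Option (Fin m)}

variable (I) in
/-- The position vector of a matching. -/
def posOf (M : Fin n → Option (Fin m)) : Fin n → ℕ := fun a => I.pos a (M a)

variable (I) in
/-- The matching of a position vector; positions beyond the end of a preference list stand for the
outside option. -/
def matchingOf (q : Fin n → ℕ) : Fin n → Option (Fin m) := fun a =>
  if h : q a < m + 1 then I.studentPref a ⟨q a, h⟩ else none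

theorem pos_matchingOf {a : Fin n} (h : q a ≤ m) : I.pos a (I.matchingOf q a) = q a := by
  rw [matchingOf, dif_pos (Nat.lt_succ_of_le h)]
  exact I.studentPref_eq_iff.1 rfl

theorem matchingOf_posOf (M : Fin n → Option (Fin m)) : I.matchingOf (I.posOf M) = M :=
  funext fun a => I.pos_injective a (pos_matchingOf (I.pos_le a _))

theorem IsStablePos.matchingOf_eq_some_iff (h : I.IsStablePos q) {a : Fin n} {b : Fin m} :
    I.matchingOf q a = some b ↔ q a = I.pos a (some b) := by
  rw [← pos_matchingOf (I := I) (h.le a), (I.pos_injective a).eq_iff]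

open Finset in
theorem IsStablePos.filter_matchingOf (h : I.IsStablePos q) (b : Fin m) :
    ({a | I.matchingOf q a = some b} : Finset (Fin n)) = I.held q b := by
  ext a
  rw [mem_filter, h.matchingOf_eq_some_iff, h.held_eq_located, mem_located]
  exact ⟨fun ha => ⟨ha.2.symm, h.isJustified.lt_pos_none ha.2.symm⟩,
    fun ha => ⟨mem_univ a, ha.1.symm⟩⟩

theorem IsStablePos.isStable (h : I.IsStablePos q) : I.IsStable (I.matchingOf q) where
  isMatching b := by
    rw [h.filter_matchingOf, card_held]
    exact min_le_left _ _
  no_blocking_pair := by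
    rintro a b ⟨hab, x, hxb, hax : I.rank b (some a) < I.rank b x⟩
    have hab : I.pos a (some b) < I.pos a (I.matchingOf q a) := hab
    have hr : I.Rejects q b a := h.isJustified.rejects (pos_matchingOf (I := I) (h.le a) ▸ hab)
    cases x with
    | none =>
      refine (lt_irrefl (I.quota b)) ?_
      rw [IsPartner, h.filter_matchingOf, hr.card_held_eq_quota hax] at hxb
      exact hxb
    | some c =>
      have hc := h.mem_held (h.matchingOf_eq_some_iff.1 hxb).symm
      exact (SchoolInstance.mem_held.1 hc).2 (hr.of_rank_le hax.le)
  no_blocking_student a hab := (h.isJustified.le_pos_none a).not_gt <|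
    pos_matchingOf (I := I) (h.le a) ▸ hab
  no_blocking_school := by
    rintro b ⟨a, hab, hr⟩
    have ha := h.mem_held (h.matchingOf_eq_some_iff.1 hab).symm
    exact (SchoolInstance.mem_held.1 ha).2 (Or.inl hr)

theorem posOf_eq_iff {a : Fin n} {b : Fin m} : I.pos a (some b) = I.posOf M a ↔ M a = some b := by
  rw [posOf, (I.pos_injective a).eq_iff, eq_comm]

open Finset in
theorem IsStable.isSettled_posOf (h : I.IsStable M) : I.IsSettled (I.posOf M) := by
  rintro a ⟨_, b, hb, hr⟩
  rw [posOf_eq_iff] at hb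
  have hquota : I.quota b ≤ #(I.rivals (I.posOf M) b a) :=
    hr.resolve_left fun hr => h.no_blocking_school b ⟨a, hb, hr⟩
  obtain ⟨c, hc, hcM⟩ : ∃ c ∈ I.rivals (I.posOf M) b a, c ∉ ({c | M c = some b} : Finset _) := by
    by_contra! hsub
    have ha : a ∈ ({c | M c = some b} : Finset _) := by simpa using hb
    have := eq_of_subset_of_card_le hsub ((h.isMatching b).trans hquota) ▸ ha
    exact (mem_rivals.1 this).2.false
  rw [mem_rivals] at hc
  refine h.no_blocking_pair c b ⟨hc.1.lt_of_ne fun hpos => hcM ?_, some a, hb, hc.2⟩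
  simpa using posOf_eq_iff.1 hpos

open Finset in
theorem IsStable.isJustified_posOf (h : I.IsStable M) : I.IsJustified (I.posOf M) := by
  intro a i hi
  have hnone : i < I.pos a none := hi.trans_le (not_lt.1 (h.no_blocking_student a))
  obtain ⟨b, rfl⟩ := I.exists_pos_some_eq a hnone
  have not_prefers : ∀ x, I.IsPartner M b x → I.rank b x ≤ I.rank b (some a) := fun x hx =>
    not_lt.1 fun hlt => h.no_blocking_pair a b ⟨hi, x, hx, hlt⟩
  refine rejectsAt_pos.2 ⟨hnone, ?_⟩
  by_cases hfree : #{c | M c = some b} < I.quota b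
  · exact Or.inl ((not_prefers none hfree).lt_of_ne (I.rank_some_ne_rank_none b a).symm)
  · refine Or.inr ((not_lt.1 hfree).trans (card_le_card fun c hc => ?_))
    have hcM : M c = some b := by simpa using hc
    refine mem_rivals.2 ⟨(posOf_eq_iff.2 hcM).le, (not_prefers (some c) hcM).lt_of_ne ?_⟩
    rintro heq
    obtain rfl := Option.some_injective _ (I.rank_injective b heq)
    exact hi.ne (posOf_eq_iff.2 hcM)

theorem IsStable.isStablePos (h : I.IsStable M) : I.IsStablePos (I.posOf M) :=
  ⟨h.isSettled_posOf, h.isJustified_posOf⟩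

end Matchings

end SchoolInstance

/-! ### Events: a sibling pair is together at a school -/

namespace SiblingInstance

/-- The event that two students are together at a school that prefers `better` to `worse`. -/
structure Event (X : SiblingInstance) where
  better : Fin X.n
  worse : Fin X.n
  school : Fin X.m

namespace Event

variable {X : SiblingInstance} (e : X.Event)

/-- The position of the school in the list of the better student. -/
def betterPos : ℕ := X.inst.pos e.better (some e.school)

/-- The position of the school in the list of the worse student. -/
def worsePos : ℕ := X.inst.pos e.worse (some e.school)

/-- The least position vector in which both students have reached the school. -/
def floor : Fin X.n → ℕ :=
  Pi.single e.better e.betterPos ⊔ Pi.single e.worse e.worsePos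

/-- Both students are at the school. -/
def Together (q : Fin X.n → ℕ) : Prop := q e.better = e.betterPos ∧ q e.worse = e.worsePos

instance (q : Fin X.n → ℕ) : Decidable (e.Together q) := inferInstanceAs (Decidable (_ ∧ _))

/-- The school prefers the better to the worse student, and some stable matching assigns both to the
school. -/
structure Feasible : Prop where
  rank_lt : X.inst.rank e.school (some e.better) < X.inst.rank e.school (some e.worse)
  exists_together : ∃ q, X.inst.IsStablePos q ∧ e.Together q

variable {e} {q : Fin X.n → ℕ}

theorem floor_le_iff : e.floor ≤ q ↔ e.betterPos ≤ q e.better ∧ e.worsePos ≤ q e.worse := by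
  simp [floor, Pi.single, update_le_iff]

theorem floor_le_m (a : Fin X.n) : e.floor a ≤ X.m := by
  simp only [floor, Pi.sup_apply, Pi.single_apply, sup_le_iff]
  split_ifs <;> simp [betterPos, worsePos, X.inst.pos_le]

theorem Together.floor_le (hq : e.Together q) : e.floor ≤ q :=
  floor_le_iff.2 ⟨hq.1.ge, hq.2.ge⟩

theorem together_of_floor_le
    (h : X.inst.rank e.school (some e.better) < X.inst.rank e.school (some e.worse))
    (hq : X.inst.IsStablePos q) (hfloor : e.floor ≤ q) (hworse : q e.worse ≤ e.worsePos) :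
    e.Together q := by
  rw [floor_le_iff] at hfloor
  have heq : q e.worse = e.worsePos := hworse.antisymm hfloor.2
  refine ⟨(hfloor.1.antisymm (not_lt.1 fun hlt => ?_)).symm, heq⟩
  exact (SchoolInstance.mem_held.1 (hq.mem_held heq.symm)).2
    ((hq.isJustified.rejects hlt).of_rank_le h.le)

theorem Feasible.floor_le_or (h : e.Feasible) (hq : X.inst.IsStablePos q) :
    e.floor ≤ q ∨ q e.worse ≤ e.worsePos := by
  obtain ⟨r, hr, hbetter, hworse⟩ := h.exists_together
  refine or_iff_not_imp_right.2 fun hlt => floor_le_iff.2 ?_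
  rw [not_le] at hlt
  exact ⟨hq.pos_le_of_pos_lt hr hbetter.symm hworse.symm hlt, hlt.le⟩

/-- The contribution of an event is the sum of the indicators of a lower and an upper bound, and
each of these bounds holds in a sublattice of stable position vectors. -/
theorem Feasible.together_add_one [Decidable (e.floor ≤ q)] (h : e.Feasible)
    (hq : X.inst.IsStablePos q) :
    (if e.Together q then 1 else 0) + 1 =
      (if e.floor ≤ q then 1 else 0) + (if q e.worse ≤ e.worsePos then 1 else 0) := by
  have hiff : e.Together q ↔ e.floor ≤ q ∧ q e.worse ≤ e.worsePos :=
    ⟨fun ht => ⟨ht.floor_le, ht.2.le⟩, fun hb => together_of_floor_le h.rank_lt hq hb.1 hb.2⟩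
  have hor := h.floor_le_or hq
  grind

end Event

variable {X : SiblingInstance}

/-- The event that the pair `p` is together at `b`. -/
def eventOf (p : Fin X.n × Fin X.n) (b : Fin X.m) : X.Event :=
  if X.inst.rank b (some p.1) < X.inst.rank b (some p.2) then ⟨p.1, p.2, b⟩ else ⟨p.2, p.1, b⟩

theorem school_eventOf (p : Fin X.n × Fin X.n) (b : Fin X.m) : (eventOf p b).school = b := by
  unfold eventOf
  split_ifs <;> rfl

theorem rank_eventOf_lt {p : Fin X.n × Fin X.n} (hp : p.1 ≠ p.2) (b : Fin X.m) :
    X.inst.rank (eventOf p b).school (some (eventOf p b).better) <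
      X.inst.rank (eventOf p b).school (some (eventOf p b).worse) := by
  unfold eventOf
  split_ifs with h
  · exact h
  · exact (not_lt.1 h).lt_of_ne
      ((X.inst.rank_injective b).ne ((Option.some_injective _).ne hp.symm))

theorem together_eventOf_iff {p : Fin X.n × Fin X.n} {b : Fin X.m} {q : Fin X.n → ℕ} :
    (eventOf p b).Together q ↔
      q p.1 = X.inst.pos p.1 (some b) ∧ q p.2 = X.inst.pos p.2 (some b) := by
  unfold eventOf
  split_ifs
  exacts [Iff.rfl, and_comm]

end SiblingInstance

/-! ### Maximum independent sets in bipartite graphs by auctions -/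

/-- The state of an auction on a bipartite graph, with edge relation `r`, between bidders and
objects: every object that has an owner was a cheapest neighbour of its owner at the price below its
present one.  Bidders only bid on objects cheaper than `cap`. -/
structure IsAuction {β ω : Type*} (r : β → ω → Prop) (cap : ℕ) (price : ω → ℕ)
    (owner : ω → Option β) : Prop where
  owner_inj : ∀ {f f' e}, owner f = some e → owner f' = some e → f = f'
  rel_owner : ∀ {f e}, owner f = some e → r e f
  slack : ∀ {f e f'}, owner f = some e → r e f' → price f ≤ price f' + 1
  price_free : ∀ {f}, owner f = none → price f = 0
  price_le : ∀ f, price f ≤ cap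

namespace IsAuction

variable {β ω : Type*} {r : β → ω → Prop} {cap : ℕ} {price : ω → ℕ} {owner : ω → Option β}

theorem init (r : β → ω → Prop) (cap : ℕ) : IsAuction r cap 0 fun _ => none where
  owner_inj := nofun
  rel_owner := nofun
  slack := nofun
  price_free _ := rfl
  price_le _ := Nat.zero_le _

theorem bid [DecidableEq ω] (h : IsAuction r cap price owner) {e : β} {f : ω}
    (he : ∀ f', owner f' ≠ some e) (hr : r e f) (hlt : price f < cap)
    (hmin : ∀ f', r e f' → price f ≤ price f') :
    IsAuction r cap (Function.update price f (price f + 1)) (Function.update owner f (some e)) where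
  owner_inj {f₁ f₂ d} := by
    have := @h.owner_inj f₁ f₂ d
    grind
  rel_owner {f₁ d} := by
    have := @h.rel_owner f₁ d
    grind
  slack {f₁ d f₂} := by
    have := @h.slack f₁ d f₂
    grind
  price_free {f₁} := by
    have := @h.price_free f₁
    grind
  price_le f₁ := by
    have := h.price_le f₁
    grind

theorem exists_gap [Fintype ω] (price : ω → ℕ) :
    ∃ g, 1 ≤ g ∧ g ≤ Fintype.card ω + 1 ∧ ∀ f, price f ≠ g := by
  by_contra! hall
  have hsub : Finset.Icc 1 (Fintype.card ω + 1) ⊆ Finset.univ.image price := fun g hg =>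
    (hall g (Finset.mem_Icc.1 hg).1 (Finset.mem_Icc.1 hg).2).elim fun f hf => by simp [← hf]
  simpa using (Finset.card_le_card hsub).trans Finset.card_image_le

theorem sum_price_le [Fintype ω] (h : IsAuction r cap price owner) :
    ∑ f, price f ≤ Fintype.card ω * cap := by
  simpa using Finset.sum_le_card_nsmul Finset.univ price cap fun f _ => h.price_le f

open Finset in
theorem card_owned_add_card_le [Fintype β] (h : IsAuction r cap price owner) {A : Finset β}
    {B : Finset ω} (hAB : ∀ e ∈ A, ∀ f ∈ B, ¬ r e f) :
    #{f ∈ B | owner f ≠ none} + #A ≤ Fintype.card β := by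
  classical
  have hdisj : Disjoint A (univ.filter fun e => ∃ f ∈ B, owner f = some e) :=
    disjoint_left.2 fun e he he' => by
      obtain ⟨f, hf, hfe⟩ := (mem_filter.1 he').2
      exact hAB e he f hf (h.rel_owner hfe)
  have hcard : #{f ∈ B | owner f ≠ none} ≤ #{e | ∃ f ∈ B, owner f = some e} := by
    have hinj : Set.InjOn owner ({f ∈ B | owner f ≠ none} : Finset ω) := fun f hf f' _ hff => by
      obtain ⟨e, he⟩ := Option.ne_none_iff_exists'.1 (mem_filter.1 (mem_coe.1 hf)).2
      exact h.owner_inj he (hff ▸ he)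
    rw [← card_image_of_injOn hinj, ← card_image_of_injective _ (Option.some_injective β)]
    refine card_le_card fun o ho => ?_
    obtain ⟨f, hf, rfl⟩ := mem_image.1 ho
    obtain ⟨e, he⟩ := Option.ne_none_iff_exists'.1 (mem_filter.1 hf).2
    exact mem_image.2 ⟨e, mem_filter.2 ⟨mem_univ e, f, (mem_filter.1 hf).1, he⟩, he.symm⟩
  have := card_le_univ (A ∪ univ.filter fun e => ∃ f ∈ B, owner f = some e)
  rw [card_union_of_disjoint hdisj] at this
  lia

section Fintype

variable [Fintype β] [Fintype ω]

open Finset Classical in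
theorem card_le_card_owned (h : IsAuction r cap price owner) {g : ℕ} (hg : g < cap)
    (hdone : ∀ e f, r e f → price f < cap → ∃ f', owner f' = some e) (hgap : ∀ f, price f ≠ g) :
    Fintype.card β ≤
      #{e | ∀ f, r e f → g < price f} + #{f | price f < g ∧ owner f ≠ none} := by
  have hle : #{e | ¬ ∀ f, r e f → g < price f} ≤ #{f | price f < g ∧ owner f ≠ none} := by
    rw [← card_image_of_injective _ (Option.some_injective β)]
    refine (card_le_card fun o ho => ?_).trans (card_image_le (f := owner))
    obtain ⟨e, he, rfl⟩ := mem_image.1 ho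
    obtain ⟨f, hr, hf⟩ : ∃ f, r e f ∧ price f ≤ g := by simpa using he
    obtain ⟨f', hf'⟩ := hdone e f hr (hf.trans_lt hg)
    have hslack := h.slack hf' hr
    have hlt : price f' < g := by grind
    exact mem_image.2 ⟨f', mem_filter.2 ⟨mem_univ f', hlt, by simp [hf']⟩, hf'⟩
  have := card_filter_add_card_filter_not (s := (univ : Finset β))
    fun e => ∀ f, r e f → g < price f
  rw [card_univ] at this
  lia

open Finset Classical in
/-- When no bidder wants to bid, each gap between the prices yields a maximum independent set: the
owned objects below the gap form the complement of the chosen bidders, as in Kőnig's theorem. -/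
theorem card_add_card_le (h : IsAuction r cap price owner) {g : ℕ} (hg : 1 ≤ g) (hgcap : g < cap)
    (hdone : ∀ e f, r e f → price f < cap → ∃ f', owner f' = some e) (hgap : ∀ f, price f ≠ g)
    {A : Finset β} {B : Finset ω} (hAB : ∀ e ∈ A, ∀ f ∈ B, ¬ r e f) :
    #A + #B ≤ #{e | ∀ f, r e f → g < price f} + #{f | price f < g} := by
  have howned := (h.card_owned_add_card_le hAB).trans (h.card_le_card_owned hgcap hdone hgap)
  have hfree : #{f ∈ B | ¬ owner f ≠ none} ≤ #{f | price f < g ∧ ¬ owner f ≠ none} := by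
    refine card_le_card fun f hf => ?_
    rw [mem_filter, not_not] at hf
    simpa [hf.2, h.price_free hf.2] using Nat.zero_lt_of_lt hg
  have hB := card_filter_add_card_filter_not (s := B) fun f => owner f ≠ none
  have hL := card_filter_add_card_filter_not (s := {f | price f < g}) fun f => owner f ≠ none
  rw [filter_filter, filter_filter] at hL
  lia

end Fintype

end IsAuction

namespace SiblingInstance

variable {X : SiblingInstance} {l : List X.Event} {q q' : Fin X.n → ℕ}

/-- No stable matching lies above the lower bound of the event `e` and below the upper bound of the
event `f`. -/
def Conflict (l : List X.Event) (e f : Fin l.length) : Prop :=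
  ∀ p, X.inst.IsStablePos p → l[e].floor ≤ p → l[f].worsePos < p l[f].worse

open Finset Classical in
theorem countP_together_add_length (hl : ∀ e ∈ l, e.Feasible) (hq : X.inst.IsStablePos q) :
    l.countP (fun e => e.Together q) + l.length =
      #{e : Fin l.length | l[e].floor ≤ q} +
        #{f : Fin l.length | q l[f].worse ≤ l[f].worsePos} := by
  rw [card_filter, card_filter, ← sum_add_distrib]
  simp only [Fin.getElem_fin]
  rw [Fin.sum_univ_fun_getElem l fun e : X.Event =>
    (if e.floor ≤ q then 1 else 0) + (if q e.worse ≤ e.worsePos then 1 else 0)]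
  induction l with
  | nil => simp
  | cons e l ih =>
    rw [List.map_cons, List.sum_cons, ← (hl e List.mem_cons_self).together_add_one hq,
      ← ih fun e he => hl e (List.mem_cons_of_mem _ he), List.countP_cons, List.length_cons]
    simp only [decide_eq_true_eq]
    ring

open Finset Classical in
theorem countP_together_le {cap : ℕ} {price : Fin l.length → ℕ}
    {owner : Fin l.length → Option (Fin l.length)} (hl : ∀ e ∈ l, e.Feasible)
    (h : IsAuction (Conflict l) cap price owner) {g : ℕ} (hg : 1 ≤ g) (hgcap : g < cap)
    (hdone : ∀ e f, Conflict l e f → price f < cap → ∃ f', owner f' = some e)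
    (hgap : ∀ f, price f ≠ g) (hq : X.inst.IsStablePos q) (hq' : X.inst.IsStablePos q')
    (hfloor : ∀ e : Fin l.length, (∀ f, Conflict l e f → g < price f) → l[e].floor ≤ q)
    (hworse : ∀ f : Fin l.length, price f < g → q l[f].worse ≤ l[f].worsePos) :
    l.countP (fun e => e.Together q') ≤ l.countP fun e => e.Together q := by
  refine Nat.le_of_add_le_add_right (b := l.length) ?_
  rw [countP_together_add_length hl hq, countP_together_add_length hl hq']
  refine (h.card_add_card_le hg hgcap hdone hgap fun e he f hf hc =>
    (hc q' hq' (mem_filter.1 he).2).not_ge (mem_filter.1 hf).2).trans (add_le_add ?_ ?_)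
  · exact card_le_card fun e he => mem_filter.2 ⟨mem_univ e, hfloor e (by simpa using he)⟩
  · exact card_le_card (monotone_filter_right _ fun f _ hf => hworse f hf)

end SiblingInstance

namespace SiblingInstance

variable {X : SiblingInstance}

theorem Event.feasible_iff {e : X.Event} {q : Fin X.n → ℕ}
    (h : X.inst.rank e.school (some e.better) < X.inst.rank e.school (some e.worse))
    (hq : X.inst.IsReachable e.floor q) (hsettled : X.inst.IsSettled q) :
    e.Feasible ↔ X.inst.IsJustified q ∧ q e.worse ≤ e.worsePos := by
  refine ⟨fun ⟨_, p, hp, ht⟩ => ?_, fun ⟨hjust, hworse⟩ => ?_⟩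
  · exact ⟨(hq.isStablePos hsettled hp ht.floor_le).isJustified,
      (hq.le_of_le p hp ht.floor_le _).trans ht.2.le⟩
  · have hstable : X.inst.IsStablePos q := ⟨hsettled, hjust⟩
    exact ⟨h, q, hstable, together_of_floor_le h hstable hq.le hworse⟩

open Classical in
/-- The feasible events of the sibling pairs. -/
noncomputable def feasibleEvents (X : SiblingInstance) : List X.Event :=
  X.siblings.flatMap fun p => ((List.finRange X.m).map (eventOf p)).filter fun e => e.Feasible

theorem feasible_of_mem_feasibleEvents {e : X.Event} (he : e ∈ X.feasibleEvents) : e.Feasible := by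
  obtain ⟨p, -, he⟩ := List.mem_flatMap.1 he
  simpa using (List.mem_filter.1 he).2

theorem length_feasibleEvents_le : X.feasibleEvents.length ≤ X.siblings.length * X.m := by
  rw [feasibleEvents, List.length_flatMap, ← smul_eq_mul, ← List.length_map]
  refine List.sum_le_card_nsmul _ _ fun k hk => ?_
  obtain ⟨p, -, rfl⟩ := List.mem_map.1 hk
  exact (List.length_filter_le ..).trans (by simp)

open Classical in
theorem countP_together_filter_feasible {q : Fin X.n → ℕ} (hq : X.inst.IsStablePos q)
    {p : Fin X.n × Fin X.n} (hp : p.1 ≠ p.2) :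
    (((List.finRange X.m).map (eventOf p)).filter fun e => e.Feasible).countP
      (fun e => e.Together q) = if X.SameSchool (X.inst.matchingOf q) p then 1 else 0 := by
  have hiff (b : Fin X.m) : (eventOf p b).Together q ∧ (eventOf p b).Feasible ↔
      X.inst.matchingOf q p.1 = some b ∧ X.inst.matchingOf q p.2 = some b := by
    rw [and_iff_left_of_imp fun ht => ⟨rank_eventOf_lt hp b, q, hq, ht⟩, together_eventOf_iff,
      hq.matchingOf_eq_some_iff, hq.matchingOf_eq_some_iff]
  rw [List.countP_filter, List.countP_map]
  simp only [Function.comp_def, ← Bool.decide_and, hiff]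
  split_ifs with h
  · obtain ⟨b, hb⟩ := h
    rw [← List.count_eq_one_of_mem (List.nodup_finRange X.m) (List.mem_finRange b), List.count]
    refine List.countP_congr fun c _ => ?_
    simp [hb, eq_comm (a := b)]
  · simpa [List.countP_eq_zero, SameSchool] using h

open Classical in
theorem countP_together_feasibleEvents {q : Fin X.n → ℕ} (hq : X.inst.IsStablePos q) :
    X.feasibleEvents.countP (fun e => e.Together q) = X.numTogether (X.inst.matchingOf q) := by
  have hcount (p) (hp : p ∈ X.siblings) := countP_together_filter_feasible hq (X.siblings_ne p hp)
  rw [feasibleEvents, List.countP_flatMap, numTogether, ← List.countP_eq_length_filter]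
  generalize X.siblings = l at hcount
  induction l with
  | nil => rfl
  | cons p l ih =>
    rw [List.forall_mem_cons] at hcount
    rw [List.map_cons, List.sum_cons, ih hcount.2, Function.comp, hcount.1, List.countP_cons,
      add_comm]
    simp only [decide_eq_true_eq]

theorem numTogether_eq_length_iff {M : Fin X.n → Option (Fin X.m)} :
    X.numTogether M = X.siblings.length ↔ ∀ p ∈ X.siblings, X.SameSchool M p := by
  classical
  simp [numTogether]

open Classical in
theorem IsMaxTogether.isSameSchoolAnswer {M : Fin X.n → Option (Fin X.m)}
    (hM : X.IsMaxTogether M) :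
    X.IsSameSchoolAnswer (if ∀ p ∈ X.siblings, X.SameSchool M p then some M else none) := by
  split_ifs with hall
  · exact ⟨hM.1, hall⟩
  · rintro ⟨M', hM', hall'⟩
    refine hall (numTogether_eq_length_iff.1 ((List.length_filter_le _ _).antisymm ?_))
    exact (numTogether_eq_length_iff.2 hall').ge.trans (hM.2 M' hM')

end SiblingInstance

/-! ### The entries of the encoding of an instance -/

theorem getD_flatten_of_length_eq {w : ℕ} {L : List (List ℕ)} (hL : ∀ l ∈ L, l.length = w) {a i : ℕ}
    (ha : a < L.length) (hi : i < w) : L.flatten.getD (a * w + i) 0 = L[a].getD i 0 := by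
  induction L generalizing a with
  | nil => simp at ha
  | cons l L ih =>
    have hl : l.length = w := hL l List.mem_cons_self
    rw [List.flatten_cons]
    cases a with
    | zero =>
      rw [zero_mul, zero_add, List.getD_append _ _ _ _ (hl.symm ▸ hi), List.getElem_cons_zero]
    | succ a =>
      rw [List.getD_append_right _ _ _ _ (by rw [hl, Nat.succ_mul]; lia), hl,
        show (a + 1) * w + i - w = a * w + i by rw [Nat.succ_mul]; lia,
        ih (fun l hl => hL l (List.mem_cons_of_mem _ hl)) (by simpa using ha),
        List.getElem_cons_succ]

theorem getD_append_add (l l' : List ℕ) {k : ℕ} (i : ℕ) (h : l.length = k) :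
    (l ++ l').getD (k + i) 0 = l'.getD i 0 := by
  rw [List.getD_append_right _ _ _ _ (by lia), h, Nat.add_sub_cancel_left]

theorem getD_ofFn {n : ℕ} (f : Fin n → ℕ) (i : Fin n) : (List.ofFn f).getD i 0 = f i := by
  rw [List.getD_eq_getElem _ _ (by simp), List.getElem_ofFn]

theorem mul_add_lt_mul {n w a i : ℕ} (ha : a < n) (hi : i < w) : a * w + i < n * w := by
  have := Nat.mul_le_mul_right w (Nat.succ_le_of_lt ha)
  rw [Nat.succ_mul] at this
  lia

namespace SiblingInstance

theorem code_injective {k : ℕ} : Function.Injective (code (k := k)) := by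
  rintro (_ | i) (_ | j) h <;> simp_all [code, Fin.ext_iff]

theorem code_lt {k : ℕ} (x : Option (Fin k)) : code x < k + 1 := by
  cases x <;> simp [code]

variable (X : SiblingInstance)

theorem length_encode :
    X.encode.length =
      3 + X.m + X.n * (X.m + 1) + X.m * (X.n + 1) + X.siblings.length * 2 := by
  simp [encode, List.length_flatten, List.map_ofFn, Function.comp_def]
  lia

theorem getD_encode_quota (b : Fin X.m) : X.encode.getD (3 + b) 0 = X.inst.quota b := by
  rw [encode, List.append_assoc, List.append_assoc, List.append_assoc,
    getD_append_add _ _ _ (by simp), List.getD_append _ _ _ _ (by simp), getD_ofFn]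

theorem getD_encode_studentPref (a : Fin X.n) (i : Fin (X.m + 1)) :
    X.encode.getD (3 + X.m + a * (X.m + 1) + i) 0 = code (X.inst.studentPref a i) := by
  rw [encode, List.append_assoc, List.append_assoc, Nat.add_assoc,
    getD_append_add (k := 3 + X.m) _ _ _ (by simp; lia),
    List.getD_append _ _ _ _ (by
      simpa [List.length_flatten, List.map_ofFn, Function.comp_def]
        using mul_add_lt_mul a.isLt i.isLt),
    getD_flatten_of_length_eq (by simp [List.mem_ofFn]) (by simp) i.isLt, List.getElem_ofFn,
    getD_ofFn]

theorem getD_encode_schoolPref (b : Fin X.m) (i : Fin (X.n + 1)) :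
    X.encode.getD (3 + X.m + X.n * (X.m + 1) + b * (X.n + 1) + i) 0 =
      code (X.inst.schoolPref b i) := by
  rw [encode, List.append_assoc, Nat.add_assoc,
    getD_append_add (k := 3 + X.m + X.n * (X.m + 1)) _ _ _ (by
      simp [List.length_flatten, List.map_ofFn, Function.comp_def]; lia),
    List.getD_append _ _ _ _ (by
      simpa [List.length_flatten, List.map_ofFn, Function.comp_def]
        using mul_add_lt_mul b.isLt i.isLt),
    getD_flatten_of_length_eq (by simp [List.mem_ofFn]) (by simp) i.isLt, List.getElem_ofFn,
    getD_ofFn]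

theorem getD_encode_siblings {k : ℕ} (hk : k < X.siblings.length) {j : ℕ} (hj : j < 2) :
    X.encode.getD (3 + X.m + X.n * (X.m + 1) + X.m * (X.n + 1) + (k * 2 + j)) 0 =
      [code (some X.siblings[k].1), code (some X.siblings[k].2)].getD j 0 := by
  rw [encode,
    getD_append_add (k := 3 + X.m + X.n * (X.m + 1) + X.m * (X.n + 1)) _ _ _ (by
      simp [List.length_flatten, List.map_ofFn, Function.comp_def]; lia),
    getD_flatten_of_length_eq (by
      simp only [List.mem_map]; rintro _ ⟨_, _, rfl⟩; rfl) (by simpa using hk) hj,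
    List.getElem_map]

end SiblingInstance

/-! ### Structured programs -/

namespace RAM

namespace State

theorem setVar_var (s : State) (x v y : ℕ) :
    (s.setVar x v).var y = if y = x then v else s.var y := by
  simp [setVar, Function.update_apply]

theorem setVar_arr (s : State) (x v : ℕ) : (s.setVar x v).arr = s.arr := rfl

theorem setArr_var (s : State) (k i v : ℕ) : (s.setArr k i v).var = s.var := rfl

theorem setArr_arr (s : State) (k i v k' : ℕ) :
    (s.setArr k i v).arr k' = if k' = k then Function.update (s.arr k) i v else s.arr k' := by
  by_cases h : k' = k
  · subst h; simp [setArr]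
  · simp [setArr, h]

end State

/-- The memories `s` and `s'` differ at most in the variables in `V` and in the arrays in `A`. -/
structure AgreesOff (V A : List ℕ) (s s' : State) : Prop where
  var : ∀ {y}, y ∉ V → s'.var y = s.var y
  arr : ∀ {k}, k ∉ A → s'.arr k = s.arr k

namespace AgreesOff

variable {V V' A A' : List ℕ} {s s' s'' : State}

theorem refl (V A : List ℕ) (s : State) : AgreesOff V A s s := ⟨fun _ => rfl, fun _ => rfl⟩

theorem trans (h : AgreesOff V A s s') (h' : AgreesOff V A s' s'') : AgreesOff V A s s'' :=
  ⟨fun hy => (h'.var hy).trans (h.var hy), fun hk => (h'.arr hk).trans (h.arr hk)⟩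

theorem mono (h : AgreesOff V A s s') (hV : V ⊆ V') (hA : A ⊆ A') : AgreesOff V' A' s s' :=
  ⟨fun hy => h.var fun hy' => hy (hV hy'), fun hk => h.arr fun hk' => hk (hA hk')⟩

theorem setVar (A : List ℕ) (s : State) {x : ℕ} (v : ℕ) (hx : x ∈ V) :
    AgreesOff V A s (s.setVar x v) :=
  ⟨fun hy => by rw [State.setVar_var, if_neg (ne_of_mem_of_not_mem hx hy).symm], fun _ => rfl⟩

theorem setArr (V : List ℕ) (s : State) {k : ℕ} (i v : ℕ) (hk : k ∈ A) :
    AgreesOff V A s (s.setArr k i v) :=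
  ⟨fun _ => rfl, fun hk' => by rw [State.setArr_arr, if_neg (ne_of_mem_of_not_mem hk hk').symm]⟩

end AgreesOff

namespace Expr

/-- `e₁ < e₂`, as a truth value. -/
def lt (e₁ e₂ : Expr) : Expr := sub e₂ e₁

/-- `e₁ ≤ e₂`, as a truth value. -/
def le (e₁ e₂ : Expr) : Expr := sub (add e₂ (const 1)) e₁

/-- Negation of a truth value. -/
def not (e : Expr) : Expr := sub (const 1) e

/-- Disjunction of truth values. -/
def or (e₁ e₂ : Expr) : Expr := add e₁ e₂

/-- Conjunction of truth values. -/
def and (e₁ e₂ : Expr) : Expr := not (or (not e₁) (not e₂))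

/-- `e₁ = e₂`, as a truth value. -/
def eq (e₁ e₂ : Expr) : Expr := and (le e₁ e₂) (le e₂ e₁)

/-- The maximum of two values. -/
def max (e₁ e₂ : Expr) : Expr := add e₁ (sub e₂ e₁)

/-- `e` counts as true. -/
def Holds (e : Expr) (s : State) : Prop := e.eval s ≠ 0

instance (e : Expr) (s : State) : Decidable (e.Holds s) :=
  inferInstanceAs (Decidable (e.eval s ≠ 0))

variable {s : State} {e₁ e₂ : Expr}

theorem holds_lt : (lt e₁ e₂).Holds s ↔ e₁.eval s < e₂.eval s := by
  simp only [Holds, lt, eval]; lia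

theorem holds_le : (le e₁ e₂).Holds s ↔ e₁.eval s ≤ e₂.eval s := by
  simp only [Holds, le, eval]; lia

theorem holds_not : (not e₁).Holds s ↔ ¬ e₁.Holds s := by
  simp only [Holds, not, eval]; lia

theorem holds_or : (or e₁ e₂).Holds s ↔ e₁.Holds s ∨ e₂.Holds s := by
  simp only [Holds, or, eval]; lia

theorem holds_and : (and e₁ e₂).Holds s ↔ e₁.Holds s ∧ e₂.Holds s := by
  simp [and, holds_not, holds_or]

theorem holds_eq : (eq e₁ e₂).Holds s ↔ e₁.eval s = e₂.eval s := by
  rw [eq, holds_and, holds_le, holds_le, le_antisymm_iff]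

theorem eval_max : (max e₁ e₂).eval s = Max.max (e₁.eval s) (e₂.eval s) := by
  simp only [max, eval]; lia

end Expr

/-- Structured programs: every loop runs a counter `x` from `0` up to the value of a variable
`b`. -/
inductive Cmd where
  | skip
  | assign (x : ℕ) (e : Expr)
  | write (k : ℕ) (i e : Expr)
  | seq (c₁ c₂ : Cmd)
  | ite (e : Expr) (c₁ c₂ : Cmd)
  | upTo (x b : ℕ) (c : Cmd)

namespace Cmd

/-- The underlying program of the random access machine. -/
def toProg : Cmd → Prog
  | skip => .skip
  | assign x e => .assign x e
  | write k i e => .write k i e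
  | seq c₁ c₂ => .seq c₁.toProg c₂.toProg
  | ite e c₁ c₂ => .ite e c₁.toProg c₂.toProg
  | upTo x b c => .seq (.assign x (.const 0)) (.loop (.sub (.var b) (.var x))
      (.seq c.toProg (.assign x (.add (.var x) (.const 1)))))

/-- Increments the counter `x` after `f`. -/
def next (x : ℕ) (f : State → State) (s : State) : State := (f s).setVar x ((f s).var x + 1)

/-- The final memory. -/
def run : Cmd → State → State
  | skip => id
  | assign x e => fun s => s.setVar x (e.eval s)
  | write k i e => fun s => s.setArr k (i.eval s) (e.eval s)
  | seq c₁ c₂ => c₂.run ∘ c₁.run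
  | ite e c₁ c₂ => fun s => if e.Holds s then c₁.run s else c₂.run s
  | upTo x b c => fun s => (next x c.run)^[s.var b] (s.setVar x 0)

theorem run_assign (x : ℕ) (e : Expr) (s : State) : (assign x e).run s = s.setVar x (e.eval s) :=
  rfl

theorem run_write (k : ℕ) (i e : Expr) (s : State) :
    (write k i e).run s = s.setArr k (i.eval s) (e.eval s) := rfl

theorem run_seq (c₁ c₂ : Cmd) (s : State) : (seq c₁ c₂).run s = c₂.run (c₁.run s) := rfl

theorem run_ite (e : Expr) (c₁ c₂ : Cmd) (s : State) :
    (ite e c₁ c₂).run s = if e.Holds s then c₁.run s else c₂.run s := rfl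

/-- The variables to which a program assigns values. -/
def vars : Cmd → List ℕ
  | skip => []
  | assign x _ => [x]
  | write _ _ _ => []
  | seq c₁ c₂ => c₁.vars ++ c₂.vars
  | ite _ c₁ c₂ => c₁.vars ++ c₂.vars
  | upTo x _ c => x :: c.vars

/-- The arrays to which a program writes. -/
def arrs : Cmd → List ℕ
  | skip => []
  | assign _ _ => []
  | write k _ _ => [k]
  | seq c₁ c₂ => c₁.arrs ++ c₂.arrs
  | ite _ c₁ c₂ => c₁.arrs ++ c₂.arrs
  | upTo _ _ c => c.arrs

/-- The variables that bound the loops of a program. -/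
def bounds : Cmd → List ℕ
  | skip => []
  | assign _ _ => []
  | write _ _ _ => []
  | seq c₁ c₂ => c₁.bounds ++ c₂.bounds
  | ite _ c₁ c₂ => c₁.bounds ++ c₂.bounds
  | upTo _ b c => b :: c.bounds

/-- No body of a loop assigns a value to the counter of the loop. -/
def Proper : Cmd → Bool
  | skip => true
  | assign _ _ => true
  | write _ _ _ => true
  | seq c₁ c₂ => c₁.Proper && c₂.Proper
  | ite _ c₁ c₂ => c₁.Proper && c₂.Proper
  | upTo x _ c => !c.vars.contains x && c.Proper

open Polynomial in
/-- A bound for the running time in terms of a bound for the numbers of iterations of all loops. -/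
noncomputable def time : Cmd → Polynomial ℕ
  | skip => 1
  | assign _ e => C (e.cost + 1)
  | write _ i e => C (i.cost + e.cost + 1)
  | seq c₁ c₂ => c₁.time + c₂.time
  | ite e c₁ c₂ => C (e.cost + 1) + c₁.time + c₂.time
  | upTo _ _ c => X * (c.time + 8) + 6

section Iterate

variable {x b : ℕ} {c : Cmd} {s : State}

theorem agreesOff_iterate_next {V A : List ℕ} (hc : ∀ s, AgreesOff V A s (c.run s)) (hx : x ∈ V)
    (k : ℕ) (s : State) : AgreesOff V A s ((next x c.run)^[k] s) := by
  induction k with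
  | zero => exact .refl V A s
  | succ k ih =>
    rw [Function.iterate_succ_apply']
    exact ih.trans ((hc _).trans (.setVar A _ _ hx))

theorem agreesOff_run (c : Cmd) (s : State) : AgreesOff c.vars c.arrs s (c.run s) := by
  induction c generalizing s with
  | skip => exact .refl _ _ s
  | assign x e => exact .setVar _ s _ (List.mem_singleton_self x)
  | write k i e => exact .setArr _ s _ _ (List.mem_singleton_self k)
  | seq c₁ c₂ ih₁ ih₂ =>
    exact ((ih₁ s).mono (List.subset_append_left ..) (List.subset_append_left ..)).trans
      ((ih₂ _).mono (List.subset_append_right ..) (List.subset_append_right ..))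
  | ite e c₁ c₂ ih₁ ih₂ =>
    rw [run_ite]
    split_ifs
    · exact (ih₁ s).mono (List.subset_append_left ..) (List.subset_append_left ..)
    · exact (ih₂ s).mono (List.subset_append_right ..) (List.subset_append_right ..)
  | upTo x b c ih =>
    exact .trans (.setVar _ s 0 List.mem_cons_self) (agreesOff_iterate_next
      (fun s => (ih s).mono (List.subset_cons_self ..) (List.Subset.refl _)) List.mem_cons_self _ _)

theorem next_var (hx : x ∉ c.vars) : (next x c.run s).var x = s.var x + 1 := by
  rw [next, State.setVar_var, if_pos rfl, (agreesOff_run c s).var hx]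

theorem iterate_next_var (hx : x ∉ c.vars) (k : ℕ) :
    ((next x c.run)^[k] s).var x = s.var x + k := by
  induction k with
  | zero => rfl
  | succ k ih => rw [Function.iterate_succ_apply', next_var hx, ih, add_assoc]

theorem run_upTo {N : ℕ} (hN : s.var b = N) (hx : x ∉ c.vars) (I : ℕ → State → Prop)
    (hI : ∀ i s v, I i s → I i (s.setVar x v)) (h0 : I 0 s)
    (hstep : ∀ (i : Fin N) (s' : State), s'.var x = i → AgreesOff (x :: c.vars) c.arrs s s' →
      I i s' → I (i + 1) (c.run s')) :
    I N ((upTo x b c).run s) := by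
  have hagrees (i : ℕ) : AgreesOff (x :: c.vars) c.arrs s ((next x c.run)^[i] (s.setVar x 0)) :=
    .trans (.setVar _ s 0 List.mem_cons_self) (agreesOff_iterate_next
      (fun s => (agreesOff_run c s).mono (List.subset_cons_self ..) (List.Subset.refl _))
      List.mem_cons_self _ _)
  suffices hinv : ∀ i ≤ N, I i ((next x c.run)^[i] (s.setVar x 0)) by
    simpa only [run, hN] using hinv N le_rfl
  intro i
  induction i with
  | zero => exact fun _ => hI 0 s 0 h0
  | succ i ih =>
    intro hi
    rw [Function.iterate_succ_apply']
    refine hI _ _ _ (hstep ⟨i, hi⟩ _ ?_ (hagrees i) (ih (Nat.le_of_succ_le hi)))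
    rw [iterate_next_var hx, State.setVar_var, if_pos rfl, zero_add]

theorem exists_exec_loop (hx : x ∉ c.vars) (hbx : b ≠ x) (hbc : b ∉ c.vars) {T : ℕ} (k : ℕ)
    (s : State) (hk : s.var x + k = s.var b)
    (hc : ∀ s', AgreesOff (x :: c.vars) c.arrs s s' → ∃ t ≤ T, Exec c.toProg s' (c.run s') t) :
    ∃ t ≤ k * (T + 8) + 4, Exec (.loop (.sub (.var b) (.var x))
      (.seq c.toProg (.assign x (.add (.var x) (.const 1))))) s ((next x c.run)^[k] s) t := by
  induction k generalizing s with
  | zero => exact ⟨4, by simp, .loop_false (by simp only [Expr.eval]; lia)⟩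
  | succ k ih =>
    have hnext : AgreesOff (x :: c.vars) c.arrs s (next x c.run s) :=
      ((agreesOff_run c s).mono (List.subset_cons_self ..) (List.Subset.refl _)).trans
        (.setVar _ _ _ List.mem_cons_self)
    obtain ⟨t, ht, hbody⟩ := hc s (.refl _ _ s)
    obtain ⟨t', ht', hloop⟩ := ih (next x c.run s)
      (by rw [next_var hx, hnext.var (by simp [hbx, hbc])]; lia)
      fun s' hs' => hc s' (hnext.trans hs')
    refine ⟨_, ?_, .loop_true (by simp only [Expr.eval]; lia) (.seq hbody (.assign _ _ _)) hloop⟩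
    simp only [Expr.cost]
    rw [Nat.succ_mul]
    lia

end Iterate

/-- The program `c`, started with the memory `s`, halts within the time for at most `N` iterations
of every loop. -/
def HaltsIn (c : Cmd) (N : ℕ) (s : State) : Prop :=
  ∃ t ≤ c.time.eval N, Exec c.toProg s (c.run s) t

theorem HaltsIn.seq {c₁ c₂ : Cmd} {N : ℕ} {s : State} (h₁ : c₁.HaltsIn N s)
    (h₂ : c₂.HaltsIn N (c₁.run s)) : (c₁.seq c₂).HaltsIn N s := by
  obtain ⟨t₁, ht₁, h₁⟩ := h₁
  obtain ⟨t₂, ht₂, h₂⟩ := h₂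
  exact ⟨t₁ + t₂, by simpa only [time, Polynomial.eval_add] using add_le_add ht₁ ht₂, .seq h₁ h₂⟩

theorem haltsIn (c : Cmd) (hc : c.Proper) (N : ℕ) (s : State)
    (hs : ∀ b ∈ c.bounds, b ∉ c.vars ∧ s.var b ≤ N) : c.HaltsIn N s := by
  induction c generalizing s with
  | skip => exact ⟨1, by simp [time], .skip s⟩
  | assign x e => exact ⟨_, by simp [time], .assign s x e⟩
  | write k i e => exact ⟨_, by simp [time], .write s k i e⟩
  | seq c₁ c₂ ih₁ ih₂ =>
    simp only [Proper, Bool.and_eq_true] at hc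
    simp only [bounds, vars, List.mem_append, not_or] at hs
    refine (ih₁ hc.1 s fun b hb => ⟨(hs b (.inl hb)).1.1, (hs b (.inl hb)).2⟩).seq
      (ih₂ hc.2 (c₁.run s) fun b hb => ?_)
    rw [(agreesOff_run c₁ s).var (hs b (.inr hb)).1.1]
    exact ⟨(hs b (.inr hb)).1.2, (hs b (.inr hb)).2⟩
  | ite e c₁ c₂ ih₁ ih₂ =>
    simp only [Proper, Bool.and_eq_true] at hc
    simp only [bounds, vars, List.mem_append, not_or] at hs
    simp only [HaltsIn, time, Polynomial.eval_add, Polynomial.eval_C, run_ite]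
    split_ifs with he
    · obtain ⟨t, ht, h⟩ := ih₁ hc.1 s fun b hb => ⟨(hs b (.inl hb)).1.1, (hs b (.inl hb)).2⟩
      exact ⟨e.cost + 1 + t, by lia, .ite_true he h⟩
    · obtain ⟨t, ht, h⟩ := ih₂ hc.2 s fun b hb => ⟨(hs b (.inr hb)).1.2, (hs b (.inr hb)).2⟩
      exact ⟨e.cost + 1 + t, by lia, .ite_false (not_not.1 he) h⟩
  | upTo x b c ih =>
    simp only [Proper, Bool.and_eq_true, Bool.not_eq_true', List.contains_eq_mem,
      decide_eq_false_iff_not] at hc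
    simp only [bounds, vars, List.mem_cons, forall_eq_or_imp, not_or] at hs
    obtain ⟨⟨⟨hbx, hbc⟩, hbN⟩, hs⟩ := hs
    obtain ⟨t, ht, h⟩ := exists_exec_loop hc.1 hbx hbc (s.var b) (s.setVar x 0)
      (by rw [State.setVar_var, State.setVar_var, if_pos rfl, if_neg hbx, zero_add])
      fun s' hs' => ih hc.2 s' fun b' hb' => by
        rw [hs'.var (by simpa using (hs b' hb').1), State.setVar_var, if_neg (hs b' hb').1.1]
        exact ⟨(hs b' hb').1.2, (hs b' hb').2⟩
    refine ⟨2 + t, ?_, .seq (.assign s x (.const 0)) h⟩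
    have := Nat.mul_le_mul_right (c.time.eval N + 8) hbN
    simp only [time, Polynomial.eval_add, Polynomial.eval_mul, Polynomial.eval_X,
      Polynomial.eval_ofNat]
    lia

end Cmd

end RAM

/-! ### Loops -/

theorem card_filter_val_lt_succ {n : ℕ} (P : Fin n → Prop) [DecidablePred P] (i : Fin n) :
    (Finset.univ.filter fun j : Fin n => j.val < i.val + 1 ∧ P j).card =
      (Finset.univ.filter fun j : Fin n => j.val < i.val ∧ P j).card + if P i then 1 else 0 := by
  simp_rw [Nat.lt_succ_iff_lt_or_eq, or_and_right, Finset.filter_or]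
  rw [Finset.card_union_of_disjoint
    (Finset.disjoint_filter.2 fun j _ hj hj' => hj.1.ne hj'.1)]
  congr 1
  split_ifs with h
  · exact Finset.card_eq_one.2 ⟨i, by ext j; simp only [Finset.mem_filter]; grind⟩
  · exact Finset.card_eq_zero.2 (Finset.filter_eq_empty_iff.2 (by grind))

namespace RAM

/-- The first `N` cells of the array `k`. -/
def State.cells (s : State) (k N : ℕ) : Fin N → ℕ := fun i => s.arr k i

theorem AgreesOff.cells {V A : List ℕ} {s s' : State} (h : AgreesOff V A s s') {k : ℕ} (hk : k ∉ A)
    (N : ℕ) : s'.cells k N = s.cells k N :=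
  funext fun i => congrFun (h.arr hk) i

theorem State.cells_setArr (s : State) (k N : ℕ) (i : Fin N) (v : ℕ) :
    (s.setArr k i v).cells k N = Function.update (s.cells k N) i v := by
  funext j
  simp [cells, setArr_arr, Function.update_apply, Fin.ext_iff]

namespace Cmd

variable {s : State} {x b N : ℕ}

/-- Writes the values of `e` to the first cells of the array `k`. -/
def fill (x b k : ℕ) (e : Expr) : Cmd := .upTo x b (.write k (.var x) e)

theorem run_fill {k : ℕ} {e : Expr} (hN : s.var b = N) {f : Fin N → ℕ}
    (he : ∀ (i : Fin N) (s' : State), s'.var x = i → AgreesOff [x] [k] s s' →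
      s'.arr k i = s.arr k i → e.eval s' = f i) :
    ((fill x b k e).run s).cells k N = f := by
  have hloop := run_upTo (c := .write k (.var x) e) hN List.not_mem_nil
    (fun i s' => ∀ j : Fin N, s'.arr k j = if j < i then f j else s.arr k j)
    (fun _ _ _ h => h) (fun j => by simp) fun i s' hi hs' hI j => by
      have hval := he i s' hi hs' (by simp [hI i])
      have hj := hI j
      simp only [run_write, State.setArr_arr, if_true, Expr.eval, hi, hval, Function.update_apply]
      grind
  exact funext fun i => (hloop i).trans (if_pos i.isLt)

/-- Stores in the variable `c` how often `e` holds after `d`. -/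
def count (x b c : ℕ) (d : Cmd) (e : Expr) : Cmd :=
  .seq (.assign c (.const 0))
    (.upTo x b (.seq d (.ite e (.assign c (.add (.var c) (.const 1))) .skip)))

theorem run_count {c : ℕ} {d : Cmd} {e : Expr} (hN : s.var b = N) {P : Fin N → Prop}
    [DecidablePred P]
    (he : ∀ (i : Fin N) (s' : State), s'.var x = i → AgreesOff (x :: c :: d.vars) d.arrs s s' →
      (e.Holds (d.run s') ↔ P i))
    (hx : x ∉ c :: d.vars := by decide) (hc : c ∉ [x, b] ++ d.vars := by decide) :
    ((count x b c d e).run s).var c = (Finset.univ.filter P).card := by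
  simp only [List.cons_append, List.nil_append, List.mem_cons, not_or] at hx hc
  have hinit : AgreesOff (x :: c :: d.vars) d.arrs s (s.setVar c 0) := .setVar _ _ _ (by simp)
  have hloop := run_upTo (N := N) (x := x) (s := s.setVar c 0)
    (c := .seq d (.ite e (.assign c (.add (.var c) (.const 1))) .skip))
    (by rwa [State.setVar_var, if_neg (Ne.symm hc.2.1)]) (by simpa [vars] using And.symm hx)
    (fun i s' => s'.var c = (Finset.univ.filter fun j : Fin N => j.val < i ∧ P j).card)
    (fun i s' v hI => by rwa [State.setVar_var, if_neg hc.1]) (by simp [State.setVar_var])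
    fun i s' hi hs' hI => by
      have hd := (agreesOff_run d s').var hc.2.2
      rw [card_filter_val_lt_succ, run_seq, run_ite, ← hI, ← hd]
      simp only [he i s' hi (hinit.trans (hs'.mono (by simp [vars]) (by simp [arrs])))]
      split_ifs
      · simp [run_assign, State.setVar_var, Expr.eval]
      · rfl
  exact hloop.trans (congrArg Finset.card (Finset.filter_congr fun j _ => and_iff_right j.isLt))

/-- Stores in the variable `y` an index for which `e` holds after `d`. -/
def search (x b y : ℕ) (d : Cmd) (e : Expr) : Cmd :=
  .upTo x b (.seq d (.ite e (.assign y (.var x)) .skip))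

theorem run_search {y : ℕ} {d : Cmd} {e : Expr} (hN : s.var b = N) {P : Fin N → Prop}
    (he : ∀ (i : Fin N) (s' : State), s'.var x = i → AgreesOff (x :: d.vars ++ [y]) d.arrs s s' →
      (e.Holds (d.run s') ↔ P i)) (hP : ∃ i, P i)
    (hx : x ∉ y :: d.vars := by decide) (hy : y ∉ x :: d.vars := by decide) :
    ∃ i : Fin N, P i ∧ ((search x b y d e).run s).var y = i := by
  simp only [List.mem_cons, not_or] at hx hy
  have hloop := run_upTo (x := x) (c := .seq d (.ite e (.assign y (.var x)) .skip)) hN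
    (by simpa [vars] using And.symm hx)
    (fun i s' => (∃ j : Fin N, j.val < i ∧ P j) → ∃ j : Fin N, P j ∧ s'.var y = j)
    (fun i s' v hI => by simpa only [State.setVar_var, if_neg hy.1] using hI) (by simp)
    fun i s' hi hs' hI => by
      have hd := agreesOff_run d s'
      have heP := he i s' hi (hs'.mono (by simp [vars]) (by simp [arrs]))
      rw [run_seq, run_ite]
      by_cases hPi : P i
      · rw [if_pos (heP.2 hPi)]
        exact fun _ => ⟨i, hPi, by
          rw [run_assign, State.setVar_var, if_pos rfl, Expr.eval, hd.var hx.2, hi]⟩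
      · rw [if_neg (heP.not.2 hPi)]
        rintro ⟨j, hj, hPj⟩
        have hij : j ≠ i := fun h => hPi (h ▸ hPj)
        simpa only [run, id, hd.var hy.2] using hI ⟨j, by lia, hPj⟩
  obtain ⟨i, hi⟩ := hP
  exact hloop ⟨i, i.isLt, hi⟩

/-- Lowers the variable `y` to the least value of `v` where `e` holds, and stores in the variable
`z` an index at which this value is attained. -/
def minimize (x b y z : ℕ) (e v : Expr) : Cmd :=
  .upTo x b (.ite (.and e (.lt v (.var y))) (.seq (.assign y v) (.assign z (.var x))) .skip)

theorem run_minimize {y z : ℕ} {e v : Expr} (hN : s.var b = N) {P : Fin N → Prop} {f : Fin N → ℕ}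
    (he : ∀ (i : Fin N) (s' : State), s'.var x = i → AgreesOff [x, y, z] [] s s' →
      (e.Holds s' ↔ P i) ∧ v.eval s' = f i)
    (hx : x ∉ [y, z] := by decide) (hy : y ∉ [x, z] := by decide) :
    let s' := (minimize x b y z e v).run s
    s'.var y ≤ s.var y ∧ (∀ i, P i → s'.var y ≤ f i) ∧
      (s'.var y < s.var y → ∃ i : Fin N, P i ∧ s'.var z = i ∧ f i = s'.var y) := by
  simp only [List.mem_cons, List.not_mem_nil, or_false, not_or] at hx hy
  have hloop := run_upTo (x := x)
    (c := .ite (.and e (.lt v (.var y))) (.seq (.assign y v) (.assign z (.var x))) .skip) hN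
    (by simp [vars, hx])
    (fun i s' => s'.var y ≤ s.var y ∧ (∀ j : Fin N, j.val < i → P j → s'.var y ≤ f j) ∧
      (s'.var y < s.var y → ∃ j : Fin N, P j ∧ s'.var z = j ∧ f j = s'.var y))
    (fun i s' v hI => by simpa only [State.setVar_var, if_neg hy.1, if_neg (Ne.symm hx.2)] using hI)
    (by simp) fun i s' hi hs' ⟨hle, hmin, harg⟩ => by
      obtain ⟨hPi, hfi⟩ := he i s' hi (hs'.mono (by simp [vars]) (by simp [arrs]))
      have hlower : (Expr.and e (.lt v (.var y))).Holds s' ↔ P i ∧ f i < s'.var y := by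
        rw [Expr.holds_and, Expr.holds_lt, hPi, hfi, Expr.eval]
      rw [run_ite]
      by_cases hlt : P i ∧ f i < s'.var y
      · rw [if_pos (hlower.2 hlt)]
        simp only [run, Function.comp, Expr.eval]
        simp only [State.setVar_var, hfi, hi, if_neg hx.1, if_neg hy.2, if_true]
        exact ⟨by lia, fun j hj hPj => by
          rcases Nat.lt_succ_iff_lt_or_eq.1 hj with hj | hj
          · exact hlt.2.le.trans (hmin j hj hPj)
          · rw [Fin.ext hj], fun _ => ⟨i, hlt.1, rfl, rfl⟩⟩
      · rw [if_neg (hlower.not.2 hlt)]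
        refine ⟨hle, fun j hj hPj => ?_, harg⟩
        rcases Nat.lt_succ_iff_lt_or_eq.1 hj with hj | hj
        · exact hmin j hj hPj
        · obtain rfl := Fin.ext hj
          exact not_lt.1 fun h => hlt ⟨hPj, h⟩
  exact ⟨hloop.1, fun i => hloop.2.1 i i.isLt, hloop.2.2⟩

section Potential

variable {c : Cmd} {δ : Type*} {D : State → δ} {Active : δ → Fin N → Prop} {J : δ → Prop}
  {φ : δ → ℕ}

theorem run_upTo_of_potential (hD : ∀ s x v, D (s.setVar x v) = D s) (hN : s.var b = N)
    (hx : x ∉ c.vars) (hJ : J (D s))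
    (hstep : ∀ (i : Fin N) (s' : State), s'.var x = i → AgreesOff (x :: c.vars) c.arrs s s' →
      J (D s') → (¬ Active (D s') i → D (c.run s') = D s') ∧
        (Active (D s') i → J (D (c.run s')) ∧ φ (D s') < φ (D (c.run s')))) :
    let s' := (upTo x b c).run s
    J (D s') ∧ ((∀ i, ¬ Active (D s) i) ∧ D s' = D s ∨
      (∃ i, Active (D s) i) ∧ φ (D s) < φ (D s')) := by
  have hloop := run_upTo hN hx
    (fun i s' => J (D s') ∧ ((∀ j : Fin N, j.val < i → ¬ Active (D s) j) ∧
      D s' = D s ∨ (∃ j, Active (D s) j) ∧ φ (D s) < φ (D s')))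
    (fun _ _ _ h => by rwa [hD]) ⟨hJ, .inl ⟨by simp, rfl⟩⟩ fun i s' hi hs' ⟨hJ', hI⟩ => by
      obtain ⟨hidle, hactive⟩ := hstep i s' hi hs' hJ'
      by_cases h : Active (D s') i
      · refine ⟨(hactive h).1, .inr ?_⟩
        rcases hI with ⟨-, heq⟩ | ⟨hex, hlt⟩
        · exact ⟨⟨i, heq ▸ h⟩, heq ▸ (hactive h).2⟩
        · exact ⟨hex, hlt.trans (hactive h).2⟩
      · rw [hidle h]
        refine ⟨hJ', hI.imp_left fun ⟨hnot, heq⟩ => ⟨fun j hj => ?_, heq⟩⟩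
        rcases Nat.lt_succ_iff_lt_or_eq.1 hj with hj | hj
        · exact hnot j hj
        · rwa [Fin.ext hj, ← heq]
  simpa only [Fin.is_lt, forall_const] using hloop

theorem run_upTo_upTo_of_potential {y r R : ℕ} (hD : ∀ s x v, D (s.setVar x v) = D s)
    (hR : s.var r = R) (hN : s.var b = N) (hJ : J (D s)) (hφ : ∀ d, J d → φ d < R)
    (hstep : ∀ (i : Fin N) (s' : State), s'.var x = i → AgreesOff (y :: x :: c.vars) c.arrs s s' →
      J (D s') → (¬ Active (D s') i → D (c.run s') = D s') ∧
        (Active (D s') i → J (D (c.run s')) ∧ φ (D s') < φ (D (c.run s'))))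
    (hx : x ∉ c.vars := by decide) (hy : y ∉ x :: c.vars := by decide)
    (hb : b ∉ y :: x :: c.vars := by decide) :
    let s' := (upTo y r (upTo x b c)).run s
    J (D s') ∧ ∀ i, ¬ Active (D s') i := by
  have hloop := run_upTo (c := upTo x b c) hR hy
    (fun k s' => J (D s') ∧ ((∀ i, ¬ Active (D s') i) ∨ k ≤ φ (D s')))
    (fun _ _ _ h => by rwa [hD]) ⟨hJ, .inr (Nat.zero_le _)⟩ fun k s' _ hs' ⟨hJ', hI⟩ => by
      obtain ⟨hJ'', ⟨hnot, heq⟩ | ⟨⟨i, hi⟩, hlt⟩⟩ := run_upTo_of_potential (s := s')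
        hD ((hs'.var hb).trans hN) hx hJ' fun i s'' hi hs'' =>
          hstep i s'' hi (hs'.trans (hs''.mono (List.subset_cons_self ..) (List.Subset.refl _)))
      · exact ⟨hJ'', .inl (heq ▸ hnot)⟩
      · exact ⟨hJ'', .inr ((hI.resolve_left fun hnot => hnot i hi).trans_lt hlt)⟩
  exact ⟨hloop.1, hloop.2.resolve_right fun hle => (hφ _ hloop.1).not_ge hle⟩

end Potential

end Cmd

end RAM

/-! ### Deferred acceptance on the machine -/

local notation "vLen" => (0 : ℕ)
local notation "vOut" => (1 : ℕ)
local notation "vStudents" => (2 : ℕ)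
local notation "vSchools" => (3 : ℕ)
local notation "vPairs" => (4 : ℕ)
local notation "vSchoolsSucc" => (5 : ℕ)
local notation "vStudentsSucc" => (6 : ℕ)
local notation "vBase" => (7 : ℕ)
local notation "vPtr" => (8 : ℕ)
local notation "vA" => (9 : ℕ)
local notation "vB" => (10 : ℕ)
local notation "vR" => (11 : ℕ)
local notation "vI" => (12 : ℕ)
local notation "vCount" => (13 : ℕ)
local notation "vRejected" => (14 : ℕ)
local notation "vSweep" => (15 : ℕ)
local notation "vBad" => (16 : ℕ)
local notation "vBadPos" => (17 : ℕ)
local notation "vPair" => (18 : ℕ)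
local notation "vSchool" => (19 : ℕ)
local notation "vBetter" => (20 : ℕ)
local notation "vWorse" => (21 : ℕ)
local notation "vEvents" => (22 : ℕ)
local notation "vEvent" => (23 : ℕ)
local notation "vF" => (24 : ℕ)
local notation "vCap" => (25 : ℕ)
local notation "vRounds" => (26 : ℕ)
local notation "vRound" => (27 : ℕ)
local notation "vBest" => (28 : ℕ)
local notation "vArg" => (29 : ℕ)
local notation "vGap" => (30 : ℕ)
local notation "vLevel" => (31 : ℕ)
local notation "kInput" => (0 : ℕ)
local notation "kOut" => (1 : ℕ)
local notation "kPos" => (2 : ℕ)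
local notation "kPosRow" => (3 : ℕ)
local notation "kRank" => (4 : ℕ)
local notation "kRankRow" => (5 : ℕ)
local notation "kVec" => (6 : ℕ)
local notation "kWorse" => (7 : ℕ)
local notation "kBetter" => (8 : ℕ)
local notation "kWorsePos" => (9 : ℕ)
local notation "kBetterPos" => (10 : ℕ)
local notation "kPrice" => (11 : ℕ)
local notation "kOwner" => (12 : ℕ)
local notation "kBest" => (13 : ℕ)

namespace RAM

open SiblingInstance Cmd RAM.Expr

/-- The position of the alternative with code `c` in the list of student `a`. -/
def posE (a c : Expr) : Expr := .read kPos (.add (.read kPosRow a) c)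

/-- The position of the alternative with code `c` in the list of school `b`. -/
def rankE (b c : Expr) : Expr := .read kRank (.add (.read kRankRow b) c)

/-- The code of the alternative at position `i` in the list of student `a`. -/
def prefE (a i : Expr) : Expr := .read kInput (.add (.read kPosRow a) i)

/-- The quota of school `b`. -/
def quotaE (b : Expr) : Expr := .read kInput (.add (.const 3) b)

/-- The code of the agent with index `e`. -/
def codeE (e : Expr) : Expr := .add e (.const 1)

/-- The code of the first member of the sibling pair `k`. -/
def fstE (k : Expr) : Expr := .read kInput (.add (.var vBase) (.add k k))

/-- The code of the second member of the sibling pair `k`. -/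
def sndE (k : Expr) : Expr := .read kInput (.add (.add (.var vBase) (.add k k)) (.const 1))

/-- The memory holds the instance `X` and the tables of positions and ranks. -/
structure Loaded (X : SiblingInstance) (s : State) : Prop where
  len : s.var vLen = X.encode.length
  students : s.var vStudents = X.n
  schools : s.var vSchools = X.m
  pairs : s.var vPairs = X.siblings.length
  schoolsSucc : s.var vSchoolsSucc = X.m + 1
  studentsSucc : s.var vStudentsSucc = X.n + 1
  pos : ∀ (a : Fin X.n) x, s.arr kPos (s.arr kPosRow a + code x) = X.inst.pos a x
  rank : ∀ (b : Fin X.m) x, s.arr kRank (s.arr kRankRow b + code x) = X.inst.rank b x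
  quota : ∀ b : Fin X.m, s.arr kInput (3 + b) = X.inst.quota b
  pref : ∀ (a : Fin X.n) (i : Fin (X.m + 1)),
    s.arr kInput (s.arr kPosRow a + i) = code (X.inst.studentPref a i)
  fst : ∀ k : Fin X.siblings.length,
    s.arr kInput (s.var vBase + (k + k)) = code (some X.siblings[k].1)
  snd : ∀ k : Fin X.siblings.length,
    s.arr kInput (s.var vBase + (k + k) + 1) = code (some X.siblings[k].2)

/-- No variable of `V` and no array of `A` occurs in `Loaded`. -/
def isDynamic (V A : List ℕ) : Bool :=
  V.all (fun y => y == vOut || vPtr ≤ y) && A.all (fun k => k == kOut || kVec ≤ k)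

variable {X : SiblingInstance} {s s' : State}

namespace Loaded

theorem of_agreesOff {V A : List ℕ} (h : Loaded X s) (hs : AgreesOff V A s s')
    (hVA : isDynamic V A := by decide) : Loaded X s' := by
  simp only [isDynamic, Bool.and_eq_true, List.all_eq_true, Bool.or_eq_true, beq_iff_eq,
    decide_eq_true_eq] at hVA
  have hvar {y : ℕ} (hy : y ≠ vOut ∧ y < vPtr := by decide) : s'.var y = s.var y :=
    hs.var fun hmem => by have := hVA.1 y hmem; lia
  have harr {k : ℕ} (hk : k ≠ kOut ∧ k < kVec := by decide) : s'.arr k = s.arr k :=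
    hs.arr fun hmem => by have := hVA.2 k hmem; lia
  exact ⟨by rw [hvar]; exact h.len, by rw [hvar]; exact h.students, by rw [hvar]; exact h.schools,
    by rw [hvar]; exact h.pairs, by rw [hvar]; exact h.schoolsSucc,
    by rw [hvar]; exact h.studentsSucc, by rw [harr, harr]; exact h.pos,
    by rw [harr, harr]; exact h.rank, by rw [harr]; exact h.quota,
    by rw [harr, harr]; exact h.pref, by rw [harr, hvar]; exact h.fst,
    by rw [harr, hvar]; exact h.snd⟩

theorem run (h : Loaded X s) (c : Cmd) (hc : isDynamic c.vars c.arrs := by decide) :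
    Loaded X (c.run s) :=
  h.of_agreesOff (agreesOff_run c s) hc

theorem eval_posE (h : Loaded X s) {ea ec : Expr} {a : Fin X.n} (x : Option (Fin X.m))
    (ha : ea.eval s = a) (hc : ec.eval s = code x) : (posE ea ec).eval s = X.inst.pos a x := by
  simp only [posE, Expr.eval, ha, hc, h.pos]

theorem eval_rankE (h : Loaded X s) {eb ec : Expr} {b : Fin X.m} (x : Option (Fin X.n))
    (hb : eb.eval s = b) (hc : ec.eval s = code x) : (rankE eb ec).eval s = X.inst.rank b x := by
  simp only [rankE, Expr.eval, hb, hc, h.rank]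

theorem eval_quotaE (h : Loaded X s) {eb : Expr} {b : Fin X.m} (hb : eb.eval s = b) :
    (quotaE eb).eval s = X.inst.quota b := by
  simp only [quotaE, Expr.eval, hb, h.quota]

theorem eval_prefE (h : Loaded X s) {ea ei : Expr} {a : Fin X.n} {i : Fin (X.m + 1)}
    (ha : ea.eval s = a) (hi : ei.eval s = i) :
    (prefE ea ei).eval s = code (X.inst.studentPref a i) := by
  simp only [prefE, Expr.eval, ha, hi, h.pref]

theorem eval_fstE (h : Loaded X s) {e : Expr} {k : Fin X.siblings.length} (hk : e.eval s = k) :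
    (fstE e).eval s = code (some X.siblings[k].1) := by
  simp only [fstE, Expr.eval, hk, h.fst]

theorem eval_sndE (h : Loaded X s) {e : Expr} {k : Fin X.siblings.length} (hk : e.eval s = k) :
    (sndE e).eval s = code (some X.siblings[k].2) := by
  simp only [sndE, Expr.eval, hk, h.snd]

end Loaded

theorem eval_codeE {N : ℕ} {e : Expr} {i : Fin N} (h : e.eval s = i) :
    (codeE e).eval s = code (some i) := by
  rw [codeE, Expr.eval, h]; rfl

theorem eval_var_run_assign {x : ℕ} {e : Expr} :
    (Expr.var x).eval ((Cmd.assign x e).run s) = e.eval s := by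
  rw [Expr.eval, run_assign, State.setVar_var, if_pos rfl]

theorem holds_run_assign {x : ℕ} {e : Expr} :
    (Expr.var x).Holds ((Cmd.assign x e).run s) ↔ e.Holds s := by
  rw [Holds, eval_var_run_assign, Holds]

theorem eval_read {k N : ℕ} {e : Expr} {i : Fin N} (h : e.eval s = i) :
    (Expr.read k e).eval s = s.cells k N i := by
  rw [Expr.eval, h]; rfl

/-- The position vector in the array `kVec`. -/
def vec (X : SiblingInstance) (s : State) : Fin X.n → ℕ := s.cells kVec X.n

theorem eval_read_vec {i : Expr} {a : Fin X.n} (h : i.eval s = a) :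
    (Expr.read kVec i).eval s = vec X s a :=
  eval_read h

theorem vec_run_write {i v : Expr} {a : Fin X.n} (h : i.eval s = a) :
    vec X ((Cmd.write kVec i v).run s) = Function.update (vec X s) a (v.eval s) := by
  rw [vec, run_write, h, State.cells_setArr, vec]

/-- Counts the rivals of student `vA` at school `vB`. -/
def countRivals : Cmd :=
  .count vI vStudents vCount .skip
    (.and (.le (posE (.var vI) (codeE (.var vB))) (.read kVec (.var vI)))
      (.lt (rankE (.var vB) (codeE (.var vI))) (rankE (.var vB) (codeE (.var vA)))))

theorem run_countRivals (h : Loaded X s) {a : Fin X.n} {b : Fin X.m} (ha : s.var vA = a)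
    (hb : s.var vB = b) :
    (countRivals.run s).var vCount = (X.inst.rivals (vec X s) b a).card := by
  refine run_count h.students fun i s' hi hs' => ?_
  have h' := h.of_agreesOff hs'
  have hi : (Expr.var vI).eval s' = i := hi
  have ha' : (Expr.var vA).eval s' = a := (hs'.var (by decide)).trans ha
  have hb' : (Expr.var vB).eval s' = b := (hs'.var (by decide)).trans hb
  rw [run, id, holds_and, holds_le, holds_lt, h'.eval_posE _ hi (eval_codeE hb'),
    h'.eval_rankE _ hb' (eval_codeE hi), h'.eval_rankE _ hb' (eval_codeE ha'), eval_read hi,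
    hs'.cells (by decide)]
  rfl

theorem holds_rejected (h : Loaded X s) {a : Fin X.n} {b : Fin X.m} (ha : s.var vA = a)
    (hb : s.var vB = b) :
    (Expr.or (.lt (rankE (.var vB) (.const 0)) (rankE (.var vB) (codeE (.var vA))))
      (.le (quotaE (.var vB)) (.var vCount))).Holds (countRivals.run s) ↔
      X.inst.Rejects (vec X s) b a := by
  have h' := h.run countRivals
  have hs' := agreesOff_run countRivals s
  have ha' : (Expr.var vA).eval (countRivals.run s) = a := (hs'.var (by decide)).trans ha
  have hb' : (Expr.var vB).eval (countRivals.run s) = b := (hs'.var (by decide)).trans hb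
  rw [holds_or, holds_lt, holds_le, h'.eval_rankE none hb' rfl,
    h'.eval_rankE _ hb' (eval_codeE ha'), h'.eval_quotaE hb', Expr.eval, run_countRivals h ha hb]
  rfl

/-- Sets `vRejected` to whether the alternative at position `vR` of student `vA` is a school that
rejects `vA`. -/
def testRejected : Cmd :=
  .ite (.lt (.var vR) (posE (.var vA) (.const 0)))
    (.seq (.assign vB (.sub (prefE (.var vA) (.var vR)) (.const 1)))
      (.seq countRivals
        (.assign vRejected
          (.or (.lt (rankE (.var vB) (.const 0)) (rankE (.var vB) (codeE (.var vA))))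
            (.le (quotaE (.var vB)) (.var vCount))))))
    (.assign vRejected (.const 0))

theorem run_testRejected (h : Loaded X s) {a : Fin X.n} (ha : s.var vA = a) :
    (Expr.var vRejected).Holds (testRejected.run s) ↔
      X.inst.RejectsAt (vec X s) a (s.var vR) := by
  have hnone : (posE (.var vA) (.const 0)).eval s = X.inst.pos a none := h.eval_posE none ha rfl
  rw [testRejected, run_ite]
  by_cases hlt : s.var vR < X.inst.pos a none
  · obtain ⟨b, hb⟩ := X.inst.exists_pos_some_eq a hlt
    rw [if_pos (by rwa [holds_lt, hnone]), run_seq, run_seq, holds_run_assign, ← hb,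
      SchoolInstance.rejectsAt_pos, hb, and_iff_right hlt]
    refine holds_rejected (h.run _) ((agreesOff_run _ s).var (by decide) |>.trans ha) ?_
    have hpref := h.eval_prefE (ea := .var vA) (ei := .var vR)
      (i := ⟨s.var vR, Nat.lt_succ_of_le (hlt.le.trans (X.inst.pos_le a none))⟩) ha rfl
    rw [X.inst.studentPref_eq_iff.2 hb] at hpref
    rw [run_assign, State.setVar_var, if_pos rfl, Expr.eval, hpref]
    rfl
  · rw [if_neg (by rwa [holds_lt, hnone]), holds_run_assign]
    exact iff_of_false (fun h => h rfl) fun hr => hlt hr.1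

/-- Moves student `vA` one position down if it is rejected at its current position. -/
def demote : Cmd :=
  .seq (.assign vR (.read kVec (.var vA)))
    (.seq testRejected
      (.ite (.var vRejected)
        (.write kVec (.var vA) (.add (.read kVec (.var vA)) (.const 1))) .skip))

open Classical in
theorem vec_run_demote (h : Loaded X s) {a : Fin X.n} (ha : s.var vA = a) :
    vec X (demote.run s) = if X.inst.RejectsAt (vec X s) a (vec X s a) then
      Function.update (vec X s) a (vec X s a + 1) else vec X s := by
  have hvR : (Expr.var vR).eval ((Cmd.assign vR (.read kVec (.var vA))).run s) = vec X s a := by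
    rw [eval_var_run_assign, eval_read_vec (i := .var vA) ha]
  have hrej := run_testRejected (h.run (.assign vR (.read kVec (.var vA)))) (a := a)
    (((agreesOff_run _ s).var (by decide)).trans ha)
  rw [show State.var _ vR = vec X s a from hvR] at hrej
  rw [demote, run_seq, run_seq, run_ite]
  have hs := agreesOff_run (.seq (.assign vR (.read kVec (.var vA))) testRejected) s
  rw [run_seq] at hs
  set s' := testRejected.run _
  have ha' : (Expr.var vA).eval s' = a := (hs.var (by decide)).trans ha
  have hvec : vec X s' = vec X s := hs.cells (by decide) _
  split_ifs with hrun hvR' hvR'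
  · rw [vec_run_write ha', Expr.eval, eval_read_vec ha', hvec]
    rfl
  · exact absurd (hrej.1 hrun) hvR'
  · exact absurd (hrej.2 hvR') hrun
  · exact hvec

/-- Raises the position vector to the least settled one above it. -/
def raise : Cmd := .upTo vSweep vLen (.upTo vA vStudents demote)

theorem run_raise (h : Loaded X s) (hle : ∀ a, vec X s a ≤ X.m) :
    X.inst.IsReachable (vec X s) (vec X (raise.run s)) ∧
      X.inst.IsSettled (vec X (raise.run s)) := by
  refine run_upTo_upTo_of_potential (c := demote) (D := vec X)
    (J := X.inst.IsReachable (vec X s)) (Active := fun q a => X.inst.RejectsAt q a (q a))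
    (φ := fun q => ∑ a, q a) (fun _ _ _ => rfl) h.len h.students ⟨le_rfl, hle, fun p _ hp => hp⟩
    (fun q hq => ?_) fun a s' ha hs' hreach => ?_
  · calc ∑ a, q a ≤ X.n * X.m := by
          simpa using Finset.sum_le_card_nsmul Finset.univ q X.m fun a _ => hq.le_length a
      _ < X.encode.length := by rw [length_encode, Nat.mul_succ]; lia
  · have hdemote := vec_run_demote (h.of_agreesOff hs') ha
    refine ⟨fun hidle => hdemote.trans (if_neg hidle), fun hrej => ?_⟩
    rw [hdemote, if_pos hrej]
    exact ⟨hreach.update hrej, Finset.sum_lt_sum (fun b _ => le_update_self_iff.2 (Nat.le_succ _) b)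
      ⟨a, Finset.mem_univ a, by simp⟩⟩

/-- Sets `vBad` to `0` if and only if the position vector is justified. -/
def testJustified : Cmd :=
  .count vA vStudents vBad
    (.count vR vSchoolsSucc vBadPos testRejected
      (.and (.lt (.var vR) (.read kVec (.var vA))) (.not (.var vRejected))))
    (.var vBadPos)

theorem run_testJustified (h : Loaded X s) (hle : ∀ a, vec X s a ≤ X.m) :
    (testJustified.run s).var vBad = 0 ↔ X.inst.IsJustified (vec X s) := by
  classical
  rw [testJustified, run_count h.students (P := fun a =>
    ∃ r : Fin (X.m + 1), r < vec X s a ∧ ¬ X.inst.RejectsAt (vec X s) a r)]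
  · simp only [Finset.card_eq_zero, Finset.filter_eq_empty_iff, Finset.mem_univ, forall_const,
      not_exists, not_and, not_not]
    exact forall_congr' fun a => ⟨fun hr r hlt => hr ⟨r, by have := hle a; lia⟩ hlt,
      fun hr r hlt => hr r hlt⟩
  · intro a s' ha hs'
    have h' := h.of_agreesOff hs'
    have hcount := run_count (x := vR) (c := vBadPos) (d := testRejected)
      (e := .and (.lt (.var vR) (.read kVec (.var vA))) (.not (.var vRejected))) h'.schoolsSucc
      (P := fun r => r < vec X s a ∧ ¬ X.inst.RejectsAt (vec X s) a r) fun r s'' hr hs'' => ?_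
    · rw [Holds, Expr.eval, hcount, Finset.card_ne_zero]
      simp [Finset.filter_nonempty_iff]
    · have ha'' : s''.var vA = a := (hs''.var (by decide)).trans ha
      have hrej := run_testRejected (h'.of_agreesOff hs'') ha''
      have hs := hs''.trans ((agreesOff_run testRejected s'').mono
        (List.subset_cons_of_subset _ (List.subset_cons_self ..)) (List.Subset.refl _))
      have hvec : vec X s'' = vec X s :=
        (hs''.cells (by decide) _).trans (hs'.cells (by decide) _)
      have hvec' : vec X (testRejected.run s'') = vec X s :=
        (hs.cells (by decide) _).trans (hs'.cells (by decide) _)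
      rw [hvec] at hrej
      rw [holds_and, holds_lt, holds_not, hrej, hr,
        eval_read_vec (i := .var vA) ((agreesOff_run _ _).var (by decide) |>.trans ha''), hvec',
        Expr.eval, (agreesOff_run testRejected s'').var (by decide), hr]

end RAM

/-! ### Finding the feasible events on the machine -/

namespace RAM

open SiblingInstance Cmd RAM.Expr

variable {X : SiblingInstance} {s s' : State} {e : X.Event} {l : List X.Event}

/-- The data of the event `e` are stored at index `i`. -/
structure EventAt (s : State) (i : ℕ) (e : X.Event) : Prop where
  worse : s.arr kWorse i = e.worse
  better : s.arr kBetter i = e.better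
  worsePos : s.arr kWorsePos i = e.worsePos
  betterPos : s.arr kBetterPos i = e.betterPos

/-- The memory holds the list `l` of events. -/
structure HasEvents (s : State) (l : List X.Event) : Prop where
  length : s.var vEvents = l.length
  eventAt : ∀ i : Fin l.length, EventAt s i l[i]

/-- No variable of `V` and no array of `A` occurs in `HasEvents`. -/
def keepsEvents (V A : List ℕ) : Bool :=
  V.all (· != vEvents) && A.all (fun k => k < kWorse || kBetterPos < k)

theorem EventAt.of_agreesOff {i : ℕ} {V A : List ℕ} (h : EventAt s i e)
    (hs : AgreesOff V A s s') (hA : keepsEvents [] A := by decide) : EventAt s' i e := by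
  simp only [keepsEvents, List.all_nil, Bool.true_and, List.all_eq_true, Bool.or_eq_true,
    decide_eq_true_eq] at hA
  have harr {k : ℕ} (hk : kWorse ≤ k ∧ k ≤ kBetterPos := by decide) : s'.arr k = s.arr k :=
    hs.arr fun hmem => by have := hA k hmem; lia
  exact ⟨by rw [harr]; exact h.worse, by rw [harr]; exact h.better,
    by rw [harr]; exact h.worsePos, by rw [harr]; exact h.betterPos⟩

theorem EventAt.run {i : ℕ} (h : EventAt s i e) (c : Cmd)
    (hc : keepsEvents [] c.arrs := by decide) : EventAt (c.run s) i e :=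
  h.of_agreesOff (agreesOff_run c s) hc

theorem HasEvents.of_agreesOff {V A : List ℕ} (h : HasEvents s l) (hs : AgreesOff V A s s')
    (hVA : keepsEvents V A := by decide) : HasEvents s' l := by
  simp only [keepsEvents, Bool.and_eq_true, List.all_eq_true, bne_iff_ne] at hVA
  exact ⟨(hs.var fun hv => hVA.1 _ hv rfl).trans h.length, fun i =>
    (h.eventAt i).of_agreesOff hs (by simpa [keepsEvents] using hVA.2)⟩

theorem HasEvents.run (h : HasEvents s l) (c : Cmd) (hc : keepsEvents c.vars c.arrs := by decide) :
    HasEvents (c.run s) l :=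
  h.of_agreesOff (agreesOff_run c s) hc

theorem HasEvents.concat (h : HasEvents s l) (he : EventAt s l.length e) :
    HasEvents (s.setVar vEvents (l.length + 1)) (l ++ [e]) where
  length := by rw [State.setVar_var, if_pos rfl, List.length_append, List.length_singleton]
  eventAt i := by
    refine EventAt.of_agreesOff (V := [vEvents]) (A := []) ?_
      (.setVar _ _ _ (List.mem_singleton_self _))
    by_cases hi : i < l.length
    · simpa [List.getElem_append_left hi] using h.eventAt ⟨i, hi⟩
    · obtain rfl : i = ⟨l.length, by simp⟩ := Fin.ext (by have := i.isLt; simp at this; lia)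
      simpa using he

/-- Writes the least position vector in which the event `vEvent` has been reached. -/
def loadFloor : Cmd :=
  .seq (.fill vA vStudents kVec (.const 0))
    (.seq (.write kVec (.read kWorse (.var vEvent)) (.read kWorsePos (.var vEvent)))
      (.write kVec (.read kBetter (.var vEvent))
        (.max (.read kVec (.read kBetter (.var vEvent))) (.read kBetterPos (.var vEvent)))))

theorem run_loadFloor (h : Loaded X s) (he : EventAt s (s.var vEvent) e) :
    vec X (loadFloor.run s) = e.floor := by
  rw [loadFloor, run_seq, run_seq]
  have hfill : vec X ((Cmd.fill vA vStudents kVec (.const 0)).run s) = 0 :=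
    run_fill h.students fun _ _ _ _ _ => rfl
  have he₁ := he.run (.fill vA vStudents kVec (.const 0))
  rw [← (agreesOff_run (.fill vA vStudents kVec (.const 0)) s).var (y := vEvent) (by decide)] at he₁
  set s₁ := (Cmd.fill vA vStudents kVec (.const 0)).run s
  have hworse : vec X ((Cmd.write kVec (.read kWorse (.var vEvent))
      (.read kWorsePos (.var vEvent))).run s₁) = Pi.single e.worse e.worsePos := by
    rw [vec_run_write (by exact he₁.worse), hfill, Expr.eval, Expr.eval, he₁.worsePos]; rfl
  have he₂ : EventAt _ (s₁.var vEvent) e :=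
    he₁.run (.write kVec (.read kWorse (.var vEvent)) (.read kWorsePos (.var vEvent)))
  set s₂ := (Cmd.write kVec (.read kWorse (.var vEvent)) (.read kWorsePos (.var vEvent))).run s₁
  rw [vec_run_write (by exact he₂.better), eval_max, eval_read_vec (by exact he₂.better),
    hworse, Expr.eval, Expr.eval,
    show s₂.var vEvent = s₁.var vEvent from rfl, he₂.betterPos]
  funext a
  obtain rfl | ha := eq_or_ne a e.better <;> simp [Event.floor, *, sup_comm]

/-- Computes the least settled position vector in which the event `vEvent` has been reached. -/
def loadLow : Cmd := .seq loadFloor raise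

theorem run_loadLow (h : Loaded X s) (he : EventAt s (s.var vEvent) e) :
    X.inst.IsReachable e.floor (vec X (loadLow.run s)) ∧
      X.inst.IsSettled (vec X (loadLow.run s)) := by
  have hfloor := run_loadFloor h he
  rw [loadLow, run_seq, ← hfloor]
  exact run_raise (h.run loadFloor) (hfloor ▸ Event.floor_le_m)

/-- Sets `vBetter` and `vWorse` to the members of the pair `vPair`, in the order of the list of the
school `vSchool`. -/
def orderPair : Cmd :=
  .ite (.lt (rankE (.var vSchool) (fstE (.var vPair))) (rankE (.var vSchool) (sndE (.var vPair))))
    (.seq (.assign vBetter (.sub (fstE (.var vPair)) (.const 1)))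
      (.assign vWorse (.sub (sndE (.var vPair)) (.const 1))))
    (.seq (.assign vBetter (.sub (sndE (.var vPair)) (.const 1)))
      (.assign vWorse (.sub (fstE (.var vPair)) (.const 1))))

theorem run_orderPair (h : Loaded X s) {k : Fin X.siblings.length} (hk : s.var vPair = k)
    {b : Fin X.m} (hb : s.var vSchool = b) :
    (orderPair.run s).var vBetter = (eventOf X.siblings[k] b).better ∧
      (orderPair.run s).var vWorse = (eventOf X.siblings[k] b).worse := by
  have hfst {s : State} (h : Loaded X s) (hk : s.var vPair = k) :
      (Expr.sub (fstE (.var vPair)) (.const 1)).eval s = X.siblings[k].1 := by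
    rw [Expr.eval, h.eval_fstE (e := .var vPair) hk]; rfl
  have hsnd {s : State} (h : Loaded X s) (hk : s.var vPair = k) :
      (Expr.sub (sndE (.var vPair)) (.const 1)).eval s = X.siblings[k].2 := by
    rw [Expr.eval, h.eval_sndE (e := .var vPair) hk]; rfl
  have hset (v : ℕ) : Loaded X (s.setVar vBetter v) :=
    h.of_agreesOff (.setVar _ s v (List.mem_singleton_self vBetter)) (A := [])
  simp only [orderPair, run_ite, holds_lt, h.eval_rankE (eb := .var vSchool) _ hb
    (h.eval_fstE (e := .var vPair) hk), h.eval_rankE (eb := .var vSchool) _ hb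
    (h.eval_sndE (e := .var vPair) hk), eventOf]
  split_ifs
  all_goals
    rw [run_seq, run_assign, run_assign]
    simp [State.setVar_var, hfst, hsnd, h, hset, hk]

/-- Stores the event of `vBetter`, `vWorse` and `vSchool` at the index `vEvents`. -/
def storeEvent : Cmd :=
  .seq (.write kWorse (.var vEvents) (.var vWorse))
    (.seq (.write kBetter (.var vEvents) (.var vBetter))
      (.seq (.write kWorsePos (.var vEvents) (posE (.var vWorse) (codeE (.var vSchool))))
        (.write kBetterPos (.var vEvents) (posE (.var vBetter) (codeE (.var vSchool))))))

theorem run_storeEvent (h : Loaded X s) (hb : s.var vSchool = e.school)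
    (hbetter : s.var vBetter = e.better) (hworse : s.var vWorse = e.worse) :
    EventAt (storeEvent.run s) (s.var vEvents) e := by
  have hworsePos : (posE (.var vWorse) (codeE (.var vSchool))).eval s = e.worsePos :=
    h.eval_posE _ hworse (eval_codeE hb)
  have hbetterPos : (posE (.var vBetter) (codeE (.var vSchool))).eval s = e.betterPos :=
    h.eval_posE _ hbetter (eval_codeE hb)
  simp only [posE, codeE, Expr.eval, hb, hbetter, hworse] at hworsePos hbetterPos
  constructor <;>
    simp [storeEvent, run_seq, run_write, State.setArr_arr, State.setArr_var, posE, codeE,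
      Expr.eval, *]

theorem HasEvents.run_storeEvent (h : HasEvents s l) : HasEvents (storeEvent.run s) l where
  length := ((agreesOff_run RAM.storeEvent s).var (by decide)).trans h.length
  eventAt i := by
    obtain ⟨hworse, hbetter, hworsePos, hbetterPos⟩ := h.eventAt i
    have hi : (i : ℕ) ≠ l.length := i.isLt.ne
    constructor <;>
      simp [storeEvent, run_seq, run_write, State.setArr_arr, State.setArr_var, Expr.eval,
        h.length, *]

/-- Stores the event of the pair `vPair` and the school `vSchool` behind the list of events, and its
index in `vEvent`. -/
def loadEvent : Cmd := .seq orderPair (.seq storeEvent (.assign vEvent (.var vEvents)))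

theorem run_loadEvent (h : Loaded X s) (hl : HasEvents s l) {k : Fin X.siblings.length}
    (hk : s.var vPair = k) {b : Fin X.m} (hb : s.var vSchool = b) :
    HasEvents (loadEvent.run s) l ∧
      EventAt (loadEvent.run s) l.length (eventOf X.siblings[k] b) ∧
      (loadEvent.run s).var vEvent = l.length ∧
      (loadEvent.run s).var vWorse = (eventOf X.siblings[k] b).worse := by
  have hs := agreesOff_run orderPair s
  obtain ⟨hbetter, hworse⟩ := run_orderPair h hk hb
  have hl' : HasEvents (orderPair.run s) l := hl.run orderPair
  have hstore := run_storeEvent (h.run orderPair) (e := eventOf X.siblings[k] b)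
    ((hs.var (by decide)).trans (hb.trans (by rw [school_eventOf]))) hbetter hworse
  rw [hl'.length] at hstore
  have hs' := agreesOff_run storeEvent (orderPair.run s)
  rw [loadEvent, run_seq, run_seq]
  refine ⟨hl'.run_storeEvent.run _, hstore.run _, ?_, ?_⟩
  · rw [run_assign, State.setVar_var, if_pos rfl, Expr.eval, hl'.run_storeEvent.length]
  · rw [(agreesOff_run _ _).var (by decide), hs'.var (by decide), hworse]

/-- Appends the event of the pair `vPair` and the school `vSchool` if it is feasible. -/
def addEvent : Cmd :=
  .seq loadEvent (.seq loadLow (.seq testJustified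
    (.ite (.and (.not (.var vBad))
        (.le (.read kVec (.var vWorse)) (.read kWorsePos (.var vEvent))))
      (.assign vEvents (.add (.var vEvents) (.const 1))) .skip)))

open Classical in
theorem HasEvents.run_addEvent (hl : HasEvents s l) (h : Loaded X s)
    {k : Fin X.siblings.length} (hk : s.var vPair = k) {b : Fin X.m} (hb : s.var vSchool = b) :
    HasEvents (addEvent.run s) (if (eventOf X.siblings[k] b).Feasible then
      l ++ [eventOf X.siblings[k] b] else l) := by
  obtain ⟨hl₁, hevent, hindex, hworse⟩ := run_loadEvent h hl hk hb
  have hrank := rank_eventOf_lt (p := X.siblings[k]) (X.siblings_ne _ (List.getElem_mem k.isLt)) b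
  rw [addEvent, run_seq, run_seq, run_seq, run_ite]
  set s₁ := loadEvent.run s
  have h₁ : Loaded X s₁ := h.run loadEvent
  obtain ⟨hreach, hsettled⟩ := run_loadLow h₁ (hindex.symm ▸ hevent)
  have hjust := run_testJustified (h₁.run loadLow) hreach.le_length
  have hs := agreesOff_run (.seq loadLow testJustified) s₁
  have hvec : vec X (testJustified.run (loadLow.run s₁)) = vec X (loadLow.run s₁) :=
    (agreesOff_run testJustified _).cells (by decide) _
  rw [run_seq] at hs
  set s₂ := testJustified.run (loadLow.run s₁)
  have hevent₂ : EventAt s₂ _ _ := hevent.of_agreesOff hs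
  have hl₂ : HasEvents s₂ l := hl₁.of_agreesOff hs
  have hiff : (Expr.and (.not (.var vBad))
      (.le (.read kVec (.var vWorse)) (.read kWorsePos (.var vEvent)))).Holds s₂ ↔
      (eventOf X.siblings[k] b).Feasible := by
    rw [Event.feasible_iff hrank hreach hsettled, ← hjust, holds_and, holds_not, holds_le,
      eval_read_vec (i := .var vWorse) ((hs.var (by decide)).trans hworse), hvec, Expr.eval,
      Expr.eval, hs.var (y := vEvent) (by decide), hindex, hevent₂.worsePos, Holds, not_not]
    rfl
  simp only [hiff]
  split_ifs
  · simp only [run_assign, Expr.eval, hl₂.length]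
    exact hl₂.concat hevent₂
  · exact hl₂

/-- Computes the list of the feasible events. -/
def findEvents : Cmd := .upTo vPair vPairs (.upTo vSchool vSchools addEvent)

open Classical in
theorem HasEvents.run_addEvents (hl : HasEvents s l) (h : Loaded X s)
    {k : Fin X.siblings.length} (hk : s.var vPair = k) :
    HasEvents ((Cmd.upTo vSchool vSchools addEvent).run s)
      (l ++ ((List.finRange X.m).map (eventOf X.siblings[k])).filter fun e => e.Feasible) := by
  have hloop := run_upTo (x := vSchool) (c := addEvent) h.schools (by decide)
    (fun j s' => HasEvents s' (l ++ (((List.finRange X.m).take j).map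
      (eventOf X.siblings[k])).filter fun e => e.Feasible))
    (fun i s' v hI => hI.of_agreesOff (A := []) (.setVar _ _ _ (List.mem_singleton_self _)))
    (by simpa using hl) fun b s' hb hs' hI => ?_
  · simpa [List.take_of_length_le] using hloop
  · convert hI.run_addEvent (h.of_agreesOff hs') ((hs'.var (by decide)).trans hk) hb using 1
    rw [← List.take_concat_get' _ _ (by simp)]
    simp only [List.map_append, List.filter_append, List.getElem_finRange]
    split_ifs with hf <;> simpa using hf

theorem run_findEvents (h : Loaded X s) (h0 : s.var vEvents = 0) :
    HasEvents (findEvents.run s) X.feasibleEvents := by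
  classical
  have hloop := run_upTo (x := vPair) (c := .upTo vSchool vSchools addEvent) h.pairs (by decide)
    (fun k s' => HasEvents s' ((X.siblings.take k).flatMap fun p =>
      ((List.finRange X.m).map (eventOf p)).filter fun e => e.Feasible))
    (fun i s' v hI => hI.of_agreesOff (A := []) (.setVar _ _ _ (List.mem_singleton_self _)))
    ⟨h0, nofun⟩ fun k s' hk hs' hI => ?_
  · simpa only [List.take_length, feasibleEvents, findEvents] using hloop
  · convert hI.run_addEvents (h.of_agreesOff hs') hk using 1
    rw [← List.take_concat_get' _ _ k.isLt, List.flatMap_append, List.flatMap_singleton]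
    rfl

end RAM

/-! ### The auction on the machine -/

namespace SiblingInstance

variable {X : SiblingInstance} {l : List X.Event} {e f : Fin l.length} {q : Fin X.n → ℕ}

theorem Event.Feasible.isStablePos_of_isReachable {e : X.Event} (he : e.Feasible)
    (hq : X.inst.IsReachable e.floor q) (hsettled : X.inst.IsSettled q) : X.inst.IsStablePos q := by
  obtain ⟨p, hp, htogether⟩ := he.exists_together
  exact hq.isStablePos hsettled hp htogether.floor_le

theorem conflict_iff (he : l[e].Feasible) (hq : X.inst.IsReachable l[e].floor q)
    (hsettled : X.inst.IsSettled q) : Conflict l e f ↔ l[f].worsePos < q l[f].worse :=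
  ⟨fun h => h q (he.isStablePos_of_isReachable hq hsettled) hq.le,
    fun h p hp hfloor => h.trans_le (hq.le_of_le p hp hfloor _)⟩

end SiblingInstance

namespace RAM

open SiblingInstance Cmd RAM.Expr

variable {X : SiblingInstance} {s s' : State} {l : List X.Event} {e : Fin l.length}

/-- Lowers `vBest` to the least price of an event in conflict with the event whose lower bound was
settled in `kVec`, and stores the index of such an event in `vArg`. -/
def minConflictPrice : Cmd :=
  .minimize vF vEvents vBest vArg
    (.lt (.read kWorsePos (.var vF)) (.read kVec (.read kWorse (.var vF)))) (.read kPrice (.var vF))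

theorem run_minConflictPrice (hl : HasEvents s l) (hfeasible : l[e].Feasible)
    (hreach : X.inst.IsReachable l[e].floor (vec X s)) (hsettled : X.inst.IsSettled (vec X s)) :
    let s' := minConflictPrice.run s
    let price := s.cells kPrice l.length
    s'.var vBest ≤ s.var vBest ∧ (∀ f, Conflict l e f → s'.var vBest ≤ price f) ∧
      (s'.var vBest < s.var vBest →
        ∃ f, Conflict l e f ∧ s'.var vArg = f ∧ price f = s'.var vBest) := by
  refine run_minimize hl.length fun f s' hf hs => ?_
  have hevent := (hl.of_agreesOff hs).eventAt f
  have hworse : (Expr.read kWorse (.var vF)).eval s' = l[f].worse := by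
    rw [Expr.eval, Expr.eval, hf, hevent.worse]
  have hvec : vec X s' = vec X s := hs.cells (by decide) _
  rw [holds_lt, eval_read_vec hworse, hvec, Expr.eval, Expr.eval, hf, hevent.worsePos,
    conflict_iff hfeasible hreach hsettled, eval_read (i := f) (by exact hf),
    hs.cells (by decide)]
  exact ⟨Iff.rfl, rfl⟩

/-- Computes the least price `vBest` of an event in conflict with the event `vEvent`, or `vCap` if
there is none below `vCap`, and the index `vArg` of such an event. -/
def minPrice : Cmd := .seq (.seq loadLow (.assign vBest (.var vCap))) minConflictPrice

theorem run_minPrice (h : Loaded X s) (hl : HasEvents s l) (hfeasible : l[e].Feasible)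
    (he : s.var vEvent = e) :
    let s' := minPrice.run s
    let price := s.cells kPrice l.length
    (X.inst.IsReachable l[e].floor (vec X s') ∧ X.inst.IsSettled (vec X s')) ∧
      s'.var vBest ≤ s.var vCap ∧ (∀ f, Conflict l e f → s'.var vBest ≤ price f) ∧
      (s'.var vBest < s.var vCap →
        ∃ f, Conflict l e f ∧ s'.var vArg = f ∧ price f = s'.var vBest) := by
  have hlow := run_loadLow h (by rw [he]; exact hl.eventAt e)
  have hs := agreesOff_run loadLow s
  have hbest : (Cmd.run (.seq loadLow (.assign vBest (.var vCap))) s).var vBest = s.var vCap := by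
    rw [run_seq, run_assign, State.setVar_var, if_pos rfl, Expr.eval, hs.var (by decide)]
  have hprice : (Cmd.run (.seq loadLow (.assign vBest (.var vCap))) s).cells kPrice l.length =
      s.cells kPrice l.length := (agreesOff_run _ s).cells (by decide) _
  have hmin := run_minConflictPrice (hl.run (.seq loadLow (.assign vBest (.var vCap)))) hfeasible
    hlow.1 hlow.2
  rw [hbest, hprice] at hmin
  have hvec : vec X (minPrice.run s) = vec X (loadLow.run s) :=
    (agreesOff_run minConflictPrice _).cells (k := kVec) (by decide) X.n
  exact ⟨hvec.symm ▸ hlow, hmin⟩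

/-- Counts the events owned by the event `vEvent`. -/
def countOwned : Cmd :=
  .count vF vEvents vCount .skip
    (.eq (.read kOwner (.var vF)) (.add (.var vEvent) (.const 1)))

theorem run_countOwned (hl : HasEvents s l) (he : s.var vEvent = e) :
    (countOwned.run s).var vCount = 0 ↔ ∀ f, s.cells kOwner l.length f ≠ code (some e) := by
  classical
  have hcount : (countOwned.run s).var vCount =
      (Finset.univ.filter fun f => s.cells kOwner l.length f = code (some e)).card := by
    refine run_count hl.length fun f s' hf hs => ?_
    rw [run, id, holds_eq, eval_read (i := f) (by exact hf), hs.cells (by decide), Expr.eval,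
      Expr.eval, Expr.eval, hs.var (by decide), he, code]
  rw [hcount, Finset.card_eq_zero, Finset.filter_eq_empty_iff]
  simp only [Finset.mem_univ, forall_const]

/-- The prices and the encoded owners of the `N` events in the memory. -/
def bids (N : ℕ) (s : State) : (Fin N → ℕ) × (Fin N → ℕ) :=
  (s.cells kPrice N, s.cells kOwner N)

theorem AgreesOff.bids {V A : List ℕ} (h : AgreesOff V A s s') (N : ℕ)
    (hA : kPrice ∉ A ∧ kOwner ∉ A := by decide) : bids N s' = bids N s :=
  Prod.ext (h.cells hA.1 N) (h.cells hA.2 N)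

/-- Hands over the event `vArg` of price `vBest` to the event `vEvent`. -/
def takeCheapest : Cmd :=
  .seq (.write kOwner (.var vArg) (.add (.var vEvent) (.const 1)))
    (.write kPrice (.var vArg) (.add (.var vBest) (.const 1)))

theorem bids_run_takeCheapest {N : ℕ} {e f : Fin N} (he : s.var vEvent = e) (hf : s.var vArg = f)
    (hbest : s.cells kPrice N f = s.var vBest) :
    bids N (takeCheapest.run s) =
      (Function.update (bids N s).1 f ((bids N s).1 f + 1),
        Function.update (bids N s).2 f (code (some e))) := by
  simp only [takeCheapest, run_seq, run_write, Expr.eval, State.setArr_var, he, hf, ← hbest]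
  exact congrArg₂ Prod.mk (State.cells_setArr ..) (State.cells_setArr s kOwner N f (e + 1))

/-- If the event `vEvent` owns no event, it takes the cheapest event in conflict with it. -/
def placeBid : Cmd :=
  .seq countOwned (.ite (.not (.var vCount))
    (.seq minPrice (.ite (.lt (.var vBest) (.var vCap)) takeCheapest .skip)) .skip)

/-- The event `e` owns no event, and some event in conflict with it has a price below `cap`. Here
`d` consists of the prices and the encoded owners. -/
def MayBid (l : List X.Event) (cap : ℕ) (d : (Fin l.length → ℕ) × (Fin l.length → ℕ))
    (e : Fin l.length) : Prop :=
  (∀ f, d.2 f ≠ code (some e)) ∧ ∃ f, Conflict l e f ∧ d.1 f < cap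

theorem run_placeBid (h : Loaded X s) (hl : HasEvents s l) (hfeasible : l[e].Feasible)
    (he : s.var vEvent = e) :
    let d := bids l.length s
    let d' := bids l.length (placeBid.run s)
    (¬ MayBid l (s.var vCap) d e → d' = d) ∧
      (MayBid l (s.var vCap) d e → ∃ f, Conflict l e f ∧ d.1 f < s.var vCap ∧
        (∀ f', Conflict l e f' → d.1 f ≤ d.1 f') ∧
        d' = (Function.update d.1 f (d.1 f + 1), Function.update d.2 f (code (some e)))) := by
  have hcount := run_countOwned hl he
  have hs := agreesOff_run countOwned s
  have hiff : (Expr.not (.var vCount)).Holds (countOwned.run s) ↔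
      ∀ f, s.cells kOwner l.length f ≠ code (some e) := by
    rw [holds_not, Holds, not_not, Expr.eval, hcount]
  simp only [placeBid, run_seq, run_ite, hiff]
  by_cases hidle : ∀ f, s.cells kOwner l.length f ≠ code (some e)
  swap
  · rw [if_neg hidle]
    exact ⟨fun _ => hs.bids _, fun hbid => absurd hbid.1 hidle⟩
  obtain ⟨-, -, hmin, harg⟩ := run_minPrice (h.run countOwned) (hl.run countOwned) hfeasible
    ((hs.var (by decide)).trans he)
  have hs' := agreesOff_run minPrice (countOwned.run s)
  have hcap : (minPrice.run (countOwned.run s)).var vCap = s.var vCap :=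
    (hs'.var (by decide)).trans (hs.var (by decide))
  have hprice : (countOwned.run s).cells kPrice l.length = s.cells kPrice l.length :=
    hs.cells (by decide) _
  have hbids : bids l.length (minPrice.run (countOwned.run s)) = bids l.length s :=
    (hs'.bids _).trans (hs.bids _)
  rw [hs.var (by decide), hprice] at harg
  simp only [if_pos hidle, holds_lt, Expr.eval, hcap]
  split_ifs with hlt
  · obtain ⟨f, hconflict, hf, hbest⟩ := harg hlt
    have hlt' : s.cells kPrice l.length f < s.var vCap := hbest.trans_lt hlt
    refine ⟨fun hbid => absurd ⟨hidle, f, hconflict, hlt'⟩ hbid, fun _ => ⟨f, hconflict, hlt',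
      fun f' hf' => hbest.trans_le ((hmin f' hf').trans_eq (congrFun hprice f')), ?_⟩⟩
    rw [bids_run_takeCheapest ((hs'.var (by decide)).trans ((hs.var (by decide)).trans he)) hf ?_,
      hbids]
    exact (congrFun (congrArg Prod.fst hbids) f).trans hbest
  · refine ⟨fun _ => hbids, fun ⟨_, f, hconflict, hf⟩ => absurd ?_ hlt⟩
    exact (hmin f hconflict).trans_lt ((congrFun hprice f).trans_lt hf)

/-- The prices and owners are those of an auction. -/
def IsBidding (l : List X.Event) (cap : ℕ) (d : (Fin l.length → ℕ) × (Fin l.length → ℕ)) : Prop :=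
  ∃ owner, d.2 = code ∘ owner ∧ IsAuction (Conflict l) cap d.1 owner

theorem IsBidding.bid {cap : ℕ} {d : (Fin l.length → ℕ) × (Fin l.length → ℕ)} {f : Fin l.length}
    (hd : IsBidding l cap d) (he : ∀ f', d.2 f' ≠ code (some e)) (hconflict : Conflict l e f)
    (hlt : d.1 f < cap) (hmin : ∀ f', Conflict l e f' → d.1 f ≤ d.1 f') :
    IsBidding l cap (Function.update d.1 f (d.1 f + 1), Function.update d.2 f (code (some e))) := by
  obtain ⟨owner, howner, hauction⟩ := hd
  refine ⟨Function.update owner f (some e), ?_, hauction.bid (fun f' hf' => he f' ?_)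
    hconflict hlt hmin⟩
  · rw [howner, Function.comp_update]
  · rw [howner, Function.comp_apply, hf']

theorem IsBidding.exists_owner {cap : ℕ} {d : (Fin l.length → ℕ) × (Fin l.length → ℕ)}
    (hd : IsBidding l cap d) (hdone : ∀ e, ¬ MayBid l cap d e) :
    ∃ owner, IsAuction (Conflict l) cap d.1 owner ∧
      ∀ e f, Conflict l e f → d.1 f < cap → ∃ f', owner f' = some e := by
  obtain ⟨owner, howner, hauction⟩ := hd
  refine ⟨owner, hauction, fun e f hconflict hlt => ?_⟩
  by_contra! hidle
  exact hdone e ⟨fun f' hf' => hidle f' (code_injective ((congrFun howner f').symm.trans hf')),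
    f, hconflict, hlt⟩

/-- Starts the auction: all prices are zero and no event is owned. -/
def initBids : Cmd := .seq (.fill vF vEvents kPrice (.const 0)) (.fill vF vEvents kOwner (.const 0))

theorem run_initBids {N : ℕ} (hN : s.var vEvents = N) : bids N (initBids.run s) = 0 := by
  have hprice : ((Cmd.fill vF vEvents kPrice (.const 0)).run s).cells kPrice N = 0 :=
    run_fill hN fun _ _ _ _ _ => rfl
  have howner : (initBids.run s).cells kOwner N = 0 :=
    run_fill (((agreesOff_run (.fill vF vEvents kPrice (.const 0)) s).var (by decide)).trans hN)
      fun _ _ _ _ _ => rfl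
  refine Prod.ext (((agreesOff_run (.fill vF vEvents kOwner (.const 0)) _).cells ?_ N).trans
    hprice) howner
  decide

theorem isBidding_zero (l : List X.Event) (cap : ℕ) : IsBidding l cap 0 :=
  ⟨fun _ => none, rfl, .init _ _⟩

/-- Sets the bound `vCap` of the prices, and `vRounds` to more than every possible sum of prices. -/
def setBounds : Cmd :=
  .seq (.assign vCap (.add (.var vEvents) (.const 2))) (.seq (.assign vRounds (.const 1))
    (.upTo vF vEvents (.assign vRounds (.add (.var vRounds) (.var vCap)))))

theorem run_setBounds {N : ℕ} (hN : s.var vEvents = N) :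
    (setBounds.run s).var vCap = N + 2 ∧ (setBounds.run s).var vRounds = N * (N + 2) + 1 := by
  have hloop := run_upTo (c := .assign vRounds (.add (.var vRounds) (.var vCap)))
    (s := (s.setVar vCap (N + 2)).setVar vRounds 1) (x := vF) (b := vEvents) hN (by decide)
    (fun i s' => s'.var vCap = N + 2 ∧ s'.var vRounds = i * (N + 2) + 1)
    (fun _ _ _ h => h) (by simp [State.setVar_var]) fun i s' _ _ hI => by
      simp [run_assign, State.setVar_var, Expr.eval, hI]; ring
  simpa [setBounds, run_seq, run_assign, Expr.eval, hN] using hloop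

/-- Serves bidders until no event may bid any more. -/
def runAuction : Cmd :=
  .seq (.seq initBids setBounds) (.upTo vRound vRounds (.upTo vEvent vEvents placeBid))

theorem run_runAuction (h : Loaded X s) (hl : HasEvents s l) (hfeasible : ∀ e ∈ l, e.Feasible) :
    (runAuction.run s).var vCap = l.length + 2 ∧
      ∃ owner, IsAuction (Conflict l) (l.length + 2) ((runAuction.run s).cells kPrice l.length)
        owner ∧ ∀ e f, Conflict l e f → (runAuction.run s).cells kPrice l.length f < l.length + 2 →
          ∃ f', owner f' = some e := by
  obtain ⟨hcap, hrounds⟩ := run_setBounds (hl.run initBids).length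
  have hinit : IsBidding l (l.length + 2) (bids l.length (setBounds.run (initBids.run s))) := by
    rw [(agreesOff_run setBounds _).bids, run_initBids hl.length]
    exact isBidding_zero l _
  have hs := agreesOff_run (.seq initBids setBounds) s
  rw [runAuction, run_seq, run_seq]
  rw [run_seq] at hs
  set s₁ := setBounds.run (initBids.run s)
  have hl₁ : HasEvents s₁ l := hl.of_agreesOff hs
  have hloop := run_upTo_upTo_of_potential (c := placeBid) (y := vRound) (x := vEvent)
    (D := bids l.length) (J := IsBidding l (l.length + 2)) (Active := MayBid l (l.length + 2))
    (φ := fun d => ∑ f, d.1 f) (fun _ _ _ => rfl) hrounds hl₁.length hinit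
    (fun d hd => ?_) fun e s' he hs' hd => ?_
  · exact ⟨((agreesOff_run _ _).var (by decide)).trans hcap, hloop.1.exists_owner hloop.2⟩
  · obtain ⟨_, -, hauction⟩ := hd
    simpa using Nat.lt_succ_of_le hauction.sum_price_le
  · have hcap' : s'.var vCap = l.length + 2 := (hs'.var (by decide)).trans hcap
    have hbid := run_placeBid ((h.of_agreesOff hs).of_agreesOff hs') (hl₁.of_agreesOff hs')
      (hfeasible _ (List.getElem_mem _)) he
    rw [hcap'] at hbid
    refine ⟨hbid.1, fun hmay => ?_⟩
    obtain ⟨f, hconflict, hlt, hmin, heq⟩ := hbid.2 hmay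
    rw [heq]
    exact ⟨hd.bid hmay.1 hconflict hlt hmin,
      Fintype.sum_strictMono (lt_update_self_iff.2 (Nat.lt_succ_self _))⟩

end RAM

/-! ### Optimization on the machine -/

namespace RAM

open SiblingInstance Cmd RAM.Expr

variable {X : SiblingInstance} {s s' : State} {l : List X.Event}

/-- Sets `vGap` to a positive number below `vCap` which is not a price. -/
def findGap : Cmd :=
  .search vLevel vCap vGap
    (.count vF vEvents vCount .skip (.eq (.read kPrice (.var vF)) (.var vLevel)))
    (.and (.lt (.const 0) (.var vLevel)) (.not (.var vCount)))

theorem run_findGap {N : ℕ} (hN : s.var vEvents = N) (hcap : s.var vCap = N + 2) :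
    let g := (findGap.run s).var vGap
    1 ≤ g ∧ g < N + 2 ∧ ∀ f, s.cells kPrice N f ≠ g := by
  classical
  have hsearch := run_search (P := fun i => 1 ≤ i.val ∧ ∀ f, s.cells kPrice N f ≠ i) (y := vGap)
    (d := .count vF vEvents vCount .skip (.eq (.read kPrice (.var vF)) (.var vLevel)))
    (e := .and (.lt (.const 0) (.var vLevel)) (.not (.var vCount))) (x := vLevel) hcap
    (fun i s' hi hs => ?_) ?_
  · obtain ⟨i, ⟨hi, hf⟩, heq⟩ := hsearch
    simp only [findGap, heq]
    exact ⟨hi, i.isLt, hf⟩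
  · have hcount := run_count (s := s') (P := fun f => s.cells kPrice N f = i) (c := vCount)
      (d := .skip) (e := .eq (.read kPrice (.var vF)) (.var vLevel)) (x := vF) (b := vEvents)
      ((hs.var (by decide)).trans hN) fun f s'' hf hs' => by
        rw [run, id, holds_eq, eval_read (i := f) (by exact hf), Expr.eval,
          hs'.cells (by decide), hs.cells (by decide), hs'.var (by decide), hi]
    rw [holds_and, holds_lt, holds_not, Holds, not_not, Expr.eval, Expr.eval, Expr.eval, hcount,
      (agreesOff_run (.count vF vEvents vCount .skip _) s').var (by decide), hi,
      Finset.card_eq_zero, Finset.filter_eq_empty_iff]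
    simp [Nat.one_le_iff_ne_zero, Nat.pos_iff_ne_zero]
  · obtain ⟨g, hpos, hle, hg⟩ := IsAuction.exists_gap (s.cells kPrice N)
    rw [Fintype.card_fin] at hle
    exact ⟨⟨g, by lia⟩, hpos, hg⟩

/-- Computes the least stable position vector. -/
def loadLeast : Cmd := .seq (.fill vA vStudents kVec (.const 0)) raise

theorem run_loadLeast (h : Loaded X s) :
    X.inst.IsStablePos (vec X (loadLeast.run s)) ∧
      ∀ p, X.inst.IsStablePos p → vec X (loadLeast.run s) ≤ p := by
  have hfill : vec X ((Cmd.fill vA vStudents kVec (.const 0)).run s) = 0 :=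
    run_fill h.students fun _ _ _ _ _ => rfl
  obtain ⟨hreach, hsettled⟩ := run_raise (h.run (.fill vA vStudents kVec (.const 0)))
    (hfill ▸ fun _ => Nat.zero_le _)
  rw [hfill] at hreach
  obtain ⟨p, hp⟩ := X.inst.exists_isStablePos
  rw [loadLeast, run_seq]
  exact ⟨hreach.isStablePos hsettled hp fun _ => Nat.zero_le _,
    fun q hq => hreach.le_of_le q hq fun _ => Nat.zero_le _⟩

/-- The position vector in the array `kBest`. -/
def best (X : SiblingInstance) (s : State) : Fin X.n → ℕ := s.cells kBest X.n

/-- Raises `kBest` to the join with `kVec`. -/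
def joinBest : Cmd :=
  .fill vA vStudents kBest (.max (.read kBest (.var vA)) (.read kVec (.var vA)))

theorem best_run_joinBest (h : Loaded X s) : best X (joinBest.run s) = best X s ⊔ vec X s :=
  run_fill h.students fun a s' ha hs hbest => by
    rw [eval_max, eval_read_vec (i := .var vA) ha, Expr.eval, Expr.eval, ha, hbest]
    exact congrArg _ (congrFun (hs.cells (by decide) _) a)

/-- The vector `q` is stable, lies above those of the first `i` events which are in conflict only
with events of prices above `g`, and below the events of prices below `g`. -/
structure IsCut (l : List X.Event) (price : Fin l.length → ℕ) (g i : ℕ) (q : Fin X.n → ℕ) :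
    Prop where
  isStablePos : X.inst.IsStablePos q
  floor_le : ∀ e : Fin l.length, e.val < i → (∀ f, Conflict l e f → g < price f) → l[e].floor ≤ q
  le_worsePos : ∀ f : Fin l.length, price f < g → q l[f].worse ≤ l[f].worsePos

/-- Joins `kBest` with the lower bound of the event `vEvent` if all events in conflict with it have
prices above `vGap`. -/
def joinEvent : Cmd := .seq minPrice (.ite (.lt (.var vGap) (.var vBest)) joinBest .skip)

theorem IsCut.run_joinEvent {g : ℕ} {e : Fin l.length} (h : Loaded X s) (hl : HasEvents s l)
    (hfeasible : l[e].Feasible) (he : s.var vEvent = e) (hg : s.var vGap = g)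
    (hcap : g < s.var vCap) (hq : IsCut l (s.cells kPrice l.length) g e (best X s)) :
    IsCut l (s.cells kPrice l.length) g (e + 1) (best X (joinEvent.run s)) := by
  classical
  obtain ⟨⟨hreach, hsettled⟩, -, hmin, harg⟩ := run_minPrice h hl hfeasible he
  have hs := agreesOff_run minPrice s
  have hbest : best X (minPrice.run s) = best X s := hs.cells (by decide) _
  have hiff : (Expr.lt (.var vGap) (.var vBest)).Holds (minPrice.run s) ↔
      ∀ f, Conflict l e f → g < s.cells kPrice l.length f := by
    rw [holds_lt, Expr.eval, Expr.eval, hs.var (by decide), hg]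
    refine ⟨fun hlt f hf => hlt.trans_le (hmin f hf), fun hall => ?_⟩
    by_contra! hle
    obtain ⟨f, hf, -, heq⟩ := harg (hle.trans_lt hcap)
    exact ((hall f hf).trans_le (heq.trans_le hle)).false
  simp only [joinEvent, run_seq, run_ite, hiff]
  split_ifs with hall
  · rw [best_run_joinBest (h.run minPrice), hbest]
    refine ⟨hq.isStablePos.sup (hfeasible.isStablePos_of_isReachable hreach hsettled),
      fun e' he' hall' => ?_, fun f hf => ?_⟩
    · rcases Nat.lt_succ_iff_lt_or_eq.1 he' with hlt | heq
      · exact (hq.floor_le e' hlt hall').trans le_sup_left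
      · obtain rfl := Fin.ext heq
        exact hreach.le.trans le_sup_right
    · refine sup_le (hq.le_worsePos f hf) (not_lt.1 fun hlt => ?_)
      exact (hall f ((conflict_iff hfeasible hreach hsettled).2 hlt)).not_gt hf
  · rw [run, id, hbest]
    refine ⟨hq.isStablePos, fun e' he' hall' => hq.floor_le e' ?_ hall', hq.le_worsePos⟩
    exact (Nat.lt_succ_iff_lt_or_eq.1 he').resolve_right fun heq => hall (Fin.ext heq ▸ hall')

/-- Serves all events. -/
def joinEvents : Cmd := .upTo vEvent vEvents joinEvent

theorem IsCut.run_joinEvents (h : Loaded X s) (hl : HasEvents s l)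
    (hfeasible : ∀ e ∈ l, e.Feasible) (hcap : s.var vGap < s.var vCap)
    (hq : IsCut l (s.cells kPrice l.length) (s.var vGap) 0 (best X s)) :
    IsCut l (s.cells kPrice l.length) (s.var vGap) l.length (best X (joinEvents.run s)) := by
  refine run_upTo hl.length (by decide)
    (fun i s' => IsCut l (s.cells kPrice l.length) (s.var vGap) i (best X s')) (fun _ _ _ h => h)
    hq fun e s' he hs hI => ?_
  rw [← hs.cells (k := kPrice) (by decide)] at hI ⊢
  exact hI.run_joinEvent (h.of_agreesOff hs) (hl.of_agreesOff hs) (hfeasible _ (List.getElem_mem _))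
    he (hs.var (by decide)) (by rwa [hs.var (by decide)])

/-- Sets `kBest` to the least stable position vector. -/
def initBest : Cmd := .seq loadLeast (.fill vA vStudents kBest (.read kVec (.var vA)))

theorem run_initBest (h : Loaded X s) (hfeasible : ∀ e ∈ l, e.Feasible)
    (price : Fin l.length → ℕ) (g : ℕ) : IsCut l price g 0 (best X (initBest.run s)) := by
  obtain ⟨hstable, hleast⟩ := run_loadLeast h
  have hfill : best X (initBest.run s) = vec X (loadLeast.run s) :=
    run_fill (h.run loadLeast).students fun a s' ha hs _ =>
      (eval_read_vec (i := .var vA) ha).trans (congrFun (hs.cells (by decide) _) a)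
  rw [hfill]
  refine ⟨hstable, fun _ h0 => absurd h0 (Nat.not_lt_zero _), fun f _ => ?_⟩
  obtain ⟨p, hp, htogether⟩ := (hfeasible _ (List.getElem_mem f.isLt)).exists_together
  exact (hleast p hp _).trans_eq htogether.2

/-- Computes a stable position vector in which the largest number of the events in the memory is
reached. -/
def optimize : Cmd :=
  .seq runAuction (.seq findGap (.seq initBest joinEvents))

theorem run_optimize (h : Loaded X s) (hl : HasEvents s l) (hfeasible : ∀ e ∈ l, e.Feasible) :
    X.inst.IsStablePos (best X (optimize.run s)) ∧ ∀ q, X.inst.IsStablePos q →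
      l.countP (fun e => e.Together q) ≤
        l.countP fun e => e.Together (best X (optimize.run s)) := by
  obtain ⟨hcap, owner, hauction, hdone⟩ := run_runAuction h hl hfeasible
  have hl₁ := hl.run runAuction
  have h₁ := h.run runAuction
  rw [optimize, run_seq, run_seq, run_seq]
  generalize runAuction.run s = s₁ at *
  obtain ⟨hpos, hlt, hgap⟩ := run_findGap hl₁.length hcap
  have hs := agreesOff_run (.seq findGap initBest) s₁
  have hgapvar := (agreesOff_run initBest (findGap.run s₁)).var (y := vGap) (by decide)
  have hcapvar := hs.var (y := vCap) (by decide)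
  have hprice := hs.cells (k := kPrice) (by decide) l.length
  have hinit := run_initBest (h₁.run findGap) hfeasible (s₁.cells kPrice l.length)
    ((findGap.run s₁).var vGap)
  have h₂ := h₁.run (.seq findGap initBest)
  have hl₂ := hl₁.run (.seq findGap initBest)
  rw [run_seq] at hcapvar hprice h₂ hl₂
  generalize initBest.run (findGap.run s₁) = s₂ at *
  rw [← hprice, ← hgapvar] at hinit
  have hcut := hinit.run_joinEvents h₂ hl₂ hfeasible (by rwa [hgapvar, hcapvar, hcap])
  rw [hprice, hgapvar] at hcut
  exact ⟨hcut.isStablePos, fun q hq => countP_together_le hfeasible hauction hpos hlt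
    hdone hgap hcut.isStablePos hq (fun e => hcut.floor_le e e.isLt) hcut.le_worsePos⟩

end RAM

/-! ### Reading the input -/

namespace RAM

open SiblingInstance Cmd RAM.Expr

variable {s : State} {k r w c p W C : ℕ}

/-- Inverts the permutation in the input from address `vPtr` on, of length `w`: the inverse has the
same address in the array `k`. -/
def invertBlock (k w : ℕ) : Cmd :=
  .upTo vI w (.write k (.add (.var vPtr) (.read kInput (.add (.var vPtr) (.var vI)))) (.var vI))

theorem run_invertBlock {σ : Fin W → Fin W} (hk : k ≠ kInput) (hw : s.var w = W)
    (hp : s.var vPtr = p) (hσ : Function.Injective σ)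
    (hin : ∀ i : Fin W, s.arr kInput (p + i) = σ i) :
    let s' := (invertBlock k w).run s
    (∀ y < p, s'.arr k y = s.arr k y) ∧ ∀ i, s'.arr k (p + σ i) = i := by
  have hloop := run_upTo (x := vI)
    (c := .write k (.add (.var vPtr) (.read kInput (.add (.var vPtr) (.var vI)))) (.var vI))
    hw (by simp [vars])
    (fun j s' => (∀ y < p, s'.arr k y = s.arr k y) ∧
      ∀ i : Fin W, i.val < j → s'.arr k (p + σ i) = i)
    (fun _ _ _ h => h) ⟨fun _ _ => rfl, fun _ h => absurd h (Nat.not_lt_zero _)⟩ ?_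
  · exact ⟨hloop.1, fun i => hloop.2 i i.isLt⟩
  rintro j s' hj hs ⟨hbelow, hinverse⟩
  have hwrite : ((write k (.add (.var vPtr) (.read kInput (.add (.var vPtr) (.var vI))))
      (.var vI)).run s').arr k = Function.update (s'.arr k) (p + σ j) j := by
    rw [run_write, State.setArr_arr, if_pos rfl]
    simp only [Expr.eval, hj, hs.var (y := vPtr) (by simp [vars]), hp,
      hs.arr (k := kInput) (by simpa [arrs] using hk.symm), hin]
  rw [hwrite]
  refine ⟨fun y hy => ?_, fun i hi => ?_⟩
  · rw [Function.update_of_ne (by lia), hbelow y hy]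
  · rcases Nat.lt_succ_iff_lt_or_eq.1 hi with hlt | heq
    · have hne : σ i ≠ σ j := hσ.ne (Fin.ne_of_lt hlt)
      rw [Function.update_of_ne (by lia), hinverse i hlt]
    · rw [Fin.ext heq, Function.update_self]

/-- Inverts the next permutation, the one with index `vA`, and stores its address in the array
`r`. -/
def invertNext (k r w : ℕ) : Cmd :=
  .seq (.write r (.var vA) (.var vPtr))
    (.seq (invertBlock k w) (.assign vPtr (.add (.var vPtr) (.var w))))

theorem run_invertNext {a : ℕ} {σ : Fin W → Fin W} (hk : k ≠ kInput) (hr : r ≠ kInput)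
    (hkr : k ≠ r) (hwI : w ≠ vI) (ha : s.var vA = a) (hw : s.var w = W) (hp : s.var vPtr = p)
    (hσ : Function.Injective σ) (hin : ∀ i : Fin W, s.arr kInput (p + i) = σ i) :
    let s' := (invertNext k r w).run s
    s'.var vPtr = p + W ∧ s'.arr r = Function.update (s.arr r) a p ∧
      (∀ y < p, s'.arr k y = s.arr k y) ∧ ∀ i, s'.arr k (p + σ i) = i := by
  set s₁ := (write r (.var vA) (.var vPtr)).run s with hs₁
  have hrow : s₁.arr r = Function.update (s.arr r) a p := by
    rw [hs₁, run_write, State.setArr_arr, if_pos rfl]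
    simp only [Expr.eval, ha, hp]
  have harr {k' : ℕ} (h : k' ≠ r) : s₁.arr k' = s.arr k' :=
    (agreesOff_run (.write r (.var vA) (.var vPtr)) s).arr (by simpa [arrs] using h)
  obtain ⟨hbelow, hinverse⟩ := run_invertBlock (s := s₁) hk hw hp hσ
    (fun i => by rw [harr hr.symm, hin])
  have hblock := agreesOff_run (invertBlock k w) s₁
  simp only [invertNext, run_seq, run_assign, State.setVar_var, State.setVar_arr, if_pos, ← hs₁]
  refine ⟨?_, (hblock.arr (by simpa [invertBlock, arrs] using hkr.symm)).trans hrow,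
    fun y hy => (hbelow y hy).trans (by rw [harr hkr]), hinverse⟩
  simp only [Expr.eval, hblock.var (y := vPtr) (by simp [invertBlock, vars]),
    hblock.var (y := w) (by simpa [invertBlock, vars] using hwI)]
  exact congrArg₂ _ hp hw

/-- Inverts the next `c` permutations. -/
def invertBlocks (k r w c : ℕ) : Cmd := .upTo vA c (invertNext k r w)

theorem run_invertBlocks {σ : Fin C → Fin W → Fin W} (hk : k ≠ kInput) (hr : r ≠ kInput)
    (hkr : k ≠ r) (hwV : w ∉ [vA, vI, vPtr]) (hw : s.var w = W) (hc : s.var c = C)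
    (hp : s.var vPtr = p) (hσ : ∀ a, Function.Injective (σ a))
    (hin : ∀ (a : Fin C) (i : Fin W), s.arr kInput (p + a * W + i) = σ a i) :
    let s' := (invertBlocks k r w c).run s
    s'.var vPtr = p + C * W ∧ (∀ a : Fin C, s'.arr r a = p + a * W) ∧
      ∀ a i, s'.arr k (p + a * W + σ a i) = i := by
  have hloop := run_upTo (x := vA) (c := invertNext k r w) hc
    (by simp [invertNext, invertBlock, vars])
    (fun a s' => s'.var vPtr = p + a * W ∧ (∀ a' : Fin C, a'.val < a → s'.arr r a' = p + a' * W) ∧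
      ∀ a' : Fin C, a'.val < a → ∀ i, s'.arr k (p + a' * W + σ a' i) = i)
    (fun _ _ _ h => h) (by simpa using hp) ?_
  · exact ⟨hloop.1, fun a => hloop.2.1 a a.isLt, fun a => hloop.2.2 a a.isLt⟩
  rintro a s' ha hs ⟨hptr, hrow, hinverse⟩
  obtain ⟨hptr', hrow', hbelow, hinverse'⟩ := run_invertNext hk hr hkr
    (fun h => hwV (by simp [h])) ha
    ((hs.var (by simpa [invertNext, invertBlock, vars] using hwV)).trans hw) hptr (hσ a)
    (fun i => by rw [hs.arr (by simp [invertNext, invertBlock, arrs, hk.symm, hr.symm]), hin])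
  refine ⟨by rw [hptr']; ring, fun a' ha' => ?_, fun a' ha' i => ?_⟩
  all_goals rcases Nat.lt_succ_iff_lt_or_eq.1 ha' with hlt | heq
  · rw [hrow', Function.update_of_ne hlt.ne, hrow a' hlt]
  · rw [hrow', Fin.ext heq, Function.update_self]
  · have hle := Nat.mul_le_mul_right W (Nat.succ_le_of_lt hlt)
    rw [hbelow _ (by have := (σ a' i).isLt; lia), hinverse a' hlt]
  · rw [Fin.ext heq, hinverse']

/-- Reads the sizes of the instance. -/
def readSizes : Cmd :=
  .seq (.assign vStudents (.read kInput (.const 0)))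
    (.seq (.assign vSchools (.read kInput (.const 1)))
      (.seq (.assign vPairs (.read kInput (.const 2)))
        (.seq (.assign vSchoolsSucc (.add (.var vSchools) (.const 1)))
          (.seq (.assign vStudentsSucc (.add (.var vStudents) (.const 1)))
            (.assign vPtr (.add (.const 3) (.var vSchools)))))))

/-- Inverts the preference lists and sets `vBase` to the address of the sibling pairs. -/
def readTables : Cmd :=
  .seq (invertBlocks kPos kPosRow vSchoolsSucc vStudents)
    (.seq (invertBlocks kRank kRankRow vStudentsSucc vSchools) (.assign vBase (.var vPtr)))

variable (X : SiblingInstance)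

theorem run_readSizes :
    let s := readSizes.run (init X.encode)
    s.var vLen = X.encode.length ∧ s.var vStudents = X.n ∧ s.var vSchools = X.m ∧
      s.var vPairs = X.siblings.length ∧ s.var vSchoolsSucc = X.m + 1 ∧
      s.var vStudentsSucc = X.n + 1 ∧ s.var vPtr = 3 + X.m ∧
      ∀ i, s.arr kInput i = X.encode.getD i 0 := by
  have hstudents : X.encode.getD 0 0 = X.n := rfl
  have hschools : X.encode.getD 1 0 = X.m := rfl
  have hpairs : X.encode.getD 2 0 = X.siblings.length := rfl
  simp [readSizes, run, State.setVar_var, State.setVar_arr, Expr.eval, init, hstudents, hschools,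
    hpairs, -List.getD_eq_getElem?_getD]

theorem run_readTables :
    let s := readTables.run (readSizes.run (init X.encode))
    s.var vBase = 3 + X.m + X.n * (X.m + 1) + X.m * (X.n + 1) ∧
      (∀ a : Fin X.n, s.arr kPosRow a = 3 + X.m + a * (X.m + 1) ∧
        ∀ i, s.arr kPos (3 + X.m + a * (X.m + 1) + code (X.inst.studentPref a i)) = i) ∧
      ∀ b : Fin X.m, s.arr kRankRow b = 3 + X.m + X.n * (X.m + 1) + b * (X.n + 1) ∧
        ∀ i, s.arr kRank (3 + X.m + X.n * (X.m + 1) + b * (X.n + 1) +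
          code (X.inst.schoolPref b i)) = i := by
  obtain ⟨-, hstudents, hschools, -, hschoolsSucc, hstudentsSucc, hptr, hinput⟩ := run_readSizes X
  generalize readSizes.run (init X.encode) = s at *
  obtain ⟨hptr₁, hrow₁, hpos⟩ := run_invertBlocks (k := kPos) (r := kPosRow)
    (σ := fun a i => ⟨code (X.inst.studentPref a i), code_lt _⟩) (by decide) (by decide)
    (by decide) (by decide) hschoolsSucc hstudents hptr
    (fun a i j h => (X.inst.studentPref a).injective (code_injective (Fin.ext_iff.1 h)))
    (fun a i => (hinput _).trans (X.getD_encode_studentPref a i))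
  have hs₁ := agreesOff_run (invertBlocks kPos kPosRow vSchoolsSucc vStudents) s
  obtain ⟨hptr₂, hrow₂, hrank⟩ := run_invertBlocks (k := kRank) (r := kRankRow)
    (σ := fun b i => ⟨code (X.inst.schoolPref b i), code_lt _⟩) (by decide) (by decide)
    (by decide) (by decide) ((hs₁.var (by decide)).trans hstudentsSucc)
    ((hs₁.var (by decide)).trans hschools) hptr₁
    (fun b i j h => (X.inst.schoolPref b).injective (code_injective (Fin.ext_iff.1 h)))
    (fun b i => by rw [hs₁.arr (by decide), hinput, getD_encode_schoolPref])
  have hs₂ := agreesOff_run (invertBlocks kRank kRankRow vStudentsSucc vSchools)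
    ((invertBlocks kPos kPosRow vSchoolsSucc vStudents).run s)
  simp only [readTables, run_seq, run_assign, State.setVar_var, State.setVar_arr, if_pos]
  rw [hs₂.arr (k := kPos) (by decide), hs₂.arr (k := kPosRow) (by decide)]
  exact ⟨hptr₂, fun a => ⟨hrow₁ a, hpos a⟩, fun b => ⟨hrow₂ b, hrank b⟩⟩

theorem loaded_run_readTables : Loaded X (readTables.run (readSizes.run (init X.encode))) := by
  obtain ⟨hbase, hpos, hrank⟩ := run_readTables X
  obtain ⟨hlen, hstudents, hschools, hpairs, hschoolsSucc, hstudentsSucc, -, hinput⟩ :=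
    run_readSizes X
  have hs := agreesOff_run readTables (readSizes.run (init X.encode))
  have hin (i : ℕ) := (congrFun (hs.arr (k := kInput) (by decide)) i).trans (hinput i)
  refine ⟨(hs.var (by decide)).trans hlen, (hs.var (by decide)).trans hstudents,
    (hs.var (by decide)).trans hschools, (hs.var (by decide)).trans hpairs,
    (hs.var (by decide)).trans hschoolsSucc, (hs.var (by decide)).trans hstudentsSucc,
    fun a x => ?_, fun b x => ?_, fun b => ?_, fun a i => ?_, fun k => ?_, fun k => ?_⟩
  · simpa [(hpos a).1, SchoolInstance.pos] using (hpos a).2 ((X.inst.studentPref a).symm x)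
  · simpa [(hrank b).1, SchoolInstance.rank] using (hrank b).2 ((X.inst.schoolPref b).symm x)
  · rw [hin, getD_encode_quota]
  · rw [(hpos a).1, hin, getD_encode_studentPref]
  · rw [hin, hbase, ← mul_two]
    exact X.getD_encode_siblings k.isLt (j := 0) two_pos
  · rw [hin, hbase, ← mul_two, Nat.add_assoc _ (k * 2) 1]
    exact X.getD_encode_siblings k.isLt (j := 1) one_lt_two

end RAM

/-! ### Writing the output -/

namespace RAM

open SiblingInstance Cmd RAM.Expr

variable {X : SiblingInstance} {s s' : State}

theorem output_eq {l : List ℕ} (hlen : s.var vOut = l.length)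
    (hl : ∀ i (hi : i < l.length), s.arr kOut i = l[i]) : output s = l := by
  rw [output, hlen]
  exact List.ext_getElem (by simp) fun i _ hi => by simpa using hl i hi

/-- The code of the partner of student `a`. -/
def partnerE (a : Expr) : Expr := prefE a (.read kBest a)

theorem Loaded.eval_partnerE (h : Loaded X s) (hq : X.inst.IsStablePos (best X s)) {e : Expr}
    {a : Fin X.n} (ha : e.eval s = a) :
    (partnerE e).eval s = code (X.inst.matchingOf (best X s) a) := by
  have hlt : best X s a < X.m + 1 := Nat.lt_succ_of_le (hq.le a)
  rw [partnerE, h.eval_prefE (i := ⟨_, hlt⟩) ha (eval_read ha), SchoolInstance.matchingOf,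
    dif_pos hlt]

/-- Writes the matching to the output, beginning at index `d`. -/
def writeMatching (d : ℕ) : Cmd :=
  .upTo vA vStudents (.write kOut (.add (.var vA) (.const d)) (partnerE (.var vA)))

theorem run_writeMatching (h : Loaded X s) (hq : X.inst.IsStablePos (best X s)) (d : ℕ)
    (a : Fin X.n) :
    ((writeMatching d).run s).arr kOut (a + d) = code (X.inst.matchingOf (best X s) a) := by
  refine run_upTo h.students (c := .write kOut (.add (.var vA) (.const d)) (partnerE (.var vA)))
    List.not_mem_nil (fun i s' => ∀ a : Fin X.n, a.val < i →
      s'.arr kOut (a + d) = code (X.inst.matchingOf (best X s) a))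
    (fun _ _ _ h => h) (fun a ha => absurd ha (Nat.not_lt_zero _)) (fun i s' hi hs hI a ha => ?_)
    a a.isLt
  have hbest : best X s' = best X s := hs.cells (by simp [arrs]) _
  have hpartner := (h.of_agreesOff hs rfl).eval_partnerE (hbest ▸ hq) (e := .var vA) hi
  rw [run_write, State.setArr_arr, if_pos rfl, hpartner, hbest]
  rcases Nat.lt_succ_iff_lt_or_eq.1 ha with hlt | heq
  · rw [Function.update_of_ne (by simp only [Expr.eval, hi]; lia), hI a hlt]
  · obtain rfl := Fin.ext heq
    simp only [Expr.eval, hi, Function.update_self]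

/-- Outputs the matching. -/
def outputMatching : Cmd := .seq (writeMatching 0) (.assign vOut (.var vStudents))

theorem output_run_outputMatching (h : Loaded X s) (hq : X.inst.IsStablePos (best X s)) :
    output (outputMatching.run s) = X.encodeMatching (X.inst.matchingOf (best X s)) := by
  refine output_eq ?_ fun i hi => ?_
  · rw [encodeMatching, List.length_ofFn]
    exact (h.run (writeMatching 0)).students
  · rw [encodeMatching, List.length_ofFn] at hi
    exact (run_writeMatching h hq 0 ⟨i, hi⟩).trans (by simp [encodeMatching])

/-- The sibling pair `k` is matched to the same school. -/
def sameSchoolE (k : Expr) : Expr :=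
  .and (partnerE (.sub (fstE k) (.const 1)))
    (.eq (partnerE (.sub (fstE k) (.const 1))) (partnerE (.sub (sndE k) (.const 1))))

theorem Loaded.holds_sameSchoolE (h : Loaded X s) (hq : X.inst.IsStablePos (best X s)) {e : Expr}
    {k : Fin X.siblings.length} (hk : e.eval s = k) :
    (sameSchoolE e).Holds s ↔ X.SameSchool (X.inst.matchingOf (best X s)) X.siblings[k] := by
  have hfst : (Expr.sub (fstE e) (.const 1)).eval s = X.siblings[k].1 := by
    rw [Expr.eval, h.eval_fstE hk]; rfl
  have hsnd : (Expr.sub (sndE e) (.const 1)).eval s = X.siblings[k].2 := by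
    rw [Expr.eval, h.eval_sndE hk]; rfl
  rw [sameSchoolE, holds_and, holds_eq, Expr.Holds, h.eval_partnerE hq hfst,
    h.eval_partnerE hq hsnd, code_injective.eq_iff, SameSchool]
  cases X.inst.matchingOf (best X s) X.siblings[k].1 <;> simp [code, eq_comm]

/-- Counts the sibling pairs that are not matched to the same school. -/
def countApart : Cmd := .count vPair vPairs vCount .skip (.not (sameSchoolE (.var vPair)))

theorem run_countApart (h : Loaded X s) (hq : X.inst.IsStablePos (best X s)) :
    (countApart.run s).var vCount = 0 ↔
      ∀ p ∈ X.siblings, X.SameSchool (X.inst.matchingOf (best X s)) p := by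
  classical
  have hcount := run_count (s := s) (x := vPair) (c := vCount) (d := .skip)
    (e := .not (sameSchoolE (.var vPair)))
    (P := fun k => ¬ X.SameSchool (X.inst.matchingOf (best X s)) X.siblings[k]) h.pairs
    fun k s' hk hs => by
      have hbest : best X s' = best X s := hs.cells (by decide) _
      rw [run, id, holds_not, ← hbest,
        (h.of_agreesOff hs).holds_sameSchoolE (hbest ▸ hq) (e := .var vPair) hk]
  rw [countApart, hcount, Finset.card_eq_zero, Finset.filter_eq_empty_iff]
  simp [List.forall_mem_iff_getElem, Fin.forall_iff]

/-- Outputs the matching if no sibling pair is apart, and otherwise that there is none. -/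
def outputAnswer : Cmd :=
  .seq countApart (.ite (.var vCount)
    (.seq (.write kOut (.const 0) (.const 0)) (.assign vOut (.const 1)))
    (.seq (writeMatching 1)
      (.seq (.write kOut (.const 0) (.const 1)) (.assign vOut (.var vStudentsSucc)))))

open Classical in
theorem output_run_outputAnswer (h : Loaded X s) (hq : X.inst.IsStablePos (best X s)) :
    output (outputAnswer.run s) = X.encodeAnswer
      (if ∀ p ∈ X.siblings, X.SameSchool (X.inst.matchingOf (best X s)) p then
        some (X.inst.matchingOf (best X s)) else none) := by
  have h₁ := h.run countApart
  have hbest : best X (countApart.run s) = best X s :=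
    (agreesOff_run countApart s).cells (by decide) _
  have hcount : (Expr.var vCount).Holds (countApart.run s) ↔ _ := (run_countApart h hq).not
  rw [outputAnswer, run_seq, run_ite]
  simp only [hcount, ite_not]
  generalize countApart.run s = s₁ at *
  split_ifs with hall
  · refine output_eq ?_ fun i hi => ?_
    · rw [encodeAnswer, encodeMatching, List.length_cons, List.length_ofFn]
      exact (h₁.run (writeMatching 1)).studentsSucc
    · rw [run_seq, run_seq, run_assign, State.setVar_arr, run_write, State.setArr_arr, if_pos rfl]
      cases i with
      | zero => rfl
      | succ i =>
        rw [encodeAnswer, encodeMatching, List.length_cons, List.length_ofFn] at hi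
        rw [Expr.eval, Function.update_of_ne (Nat.succ_ne_zero i)]
        exact (run_writeMatching h₁ (hbest ▸ hq) 1 ⟨i, Nat.lt_of_succ_lt_succ hi⟩).trans
          (by simp [encodeAnswer, encodeMatching, hbest])
  · exact output_eq rfl fun i hi => by
      obtain rfl : i = 0 := by simpa [encodeAnswer] using hi
      rfl

end RAM

/-! ### Correctness and running time -/

namespace RAM

open SiblingInstance Cmd RAM.Expr

variable {X : SiblingInstance} {s : State} {N : ℕ}

/-- Reads the input, computes an optimal stable matching and then runs `c`. -/
def solve (c : Cmd) : Cmd :=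
  .seq readSizes (.seq readTables (.seq findEvents (.seq optimize c)))

theorem hasEvents_run_findEvents (X : SiblingInstance) :
    HasEvents (findEvents.run (readTables.run (readSizes.run (init X.encode))))
      X.feasibleEvents :=
  run_findEvents (loaded_run_readTables X) ((agreesOff_run _ _).var (by decide))

/-- The memory after the computation of an optimal stable matching. -/
def optimum (X : SiblingInstance) : State :=
  optimize.run (findEvents.run (readTables.run (readSizes.run (init X.encode))))

theorem loaded_optimum (X : SiblingInstance) : Loaded X (optimum X) :=
  ((loaded_run_readTables X).run findEvents).run optimize

theorem isMaxTogether_optimum (X : SiblingInstance) :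
    X.inst.IsStablePos (best X (optimum X)) ∧
      X.IsMaxTogether (X.inst.matchingOf (best X (optimum X))) := by
  obtain ⟨hstable, hmax⟩ := run_optimize ((loaded_run_readTables X).run findEvents)
    (hasEvents_run_findEvents X) fun _ => feasible_of_mem_feasibleEvents
  refine ⟨hstable, hstable.isStable, fun M hM => ?_⟩
  have hle := hmax _ hM.isStablePos
  rwa [countP_together_feasibleEvents hM.isStablePos, SchoolInstance.matchingOf_posOf,
    countP_together_feasibleEvents hstable] at hle

/-- The variables that bound the loops. -/
abbrev boundVars : List ℕ :=
  [vLen, vStudents, vSchools, vPairs, vSchoolsSucc, vStudentsSucc, vEvents, vCap, vRounds]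

/-- All loops run at most `N` times. -/
def IsBounded (N : ℕ) (s : State) : Prop :=
  ∀ b ∈ boundVars, s.var b ≤ N

/-- The bounds of all loops of `c` occur in `boundVars` and are not changed by `c`. -/
def IsStatic (c : Cmd) : Bool :=
  c.Proper && c.bounds.all fun b => b ∉ c.vars && b ∈ boundVars

namespace IsBounded

theorem haltsIn (h : IsBounded N s) (c : Cmd) (hc : IsStatic c := by decide) : c.HaltsIn N s := by
  rw [IsStatic, Bool.and_eq_true, List.all_eq_true] at hc
  exact Cmd.haltsIn c hc.1 N s fun b hb => by
    obtain ⟨hvars, hbound⟩ : b ∉ c.vars ∧ b ∈ boundVars := by simpa using hc.2 b hb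
    exact ⟨hvars, h b hbound⟩

theorem run_of_mem (h : IsBounded N s) (c : Cmd)
    (hc : ∀ b ∈ boundVars, b ∈ c.vars → (c.run s).var b ≤ N) : IsBounded N (c.run s) := by
  intro b hb
  by_cases hbc : b ∈ c.vars
  · exact hc b hb hbc
  · exact ((agreesOff_run c s).var hbc).trans_le (h b hb)

theorem run (h : IsBounded N s) (c : Cmd) (hc : ∀ b ∈ boundVars, b ∉ c.vars := by decide) :
    IsBounded N (c.run s) :=
  h.run_of_mem c fun b hb hbc => absurd hbc (hc b hb)

theorem run_initBids_setBounds (h : IsBounded N s)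
    (hN : s.var vEvents * (s.var vEvents + 2) + 2 ≤ N) :
    IsBounded N ((Cmd.seq initBids setBounds).run s) := by
  obtain ⟨hcap, hrounds⟩ := run_setBounds ((agreesOff_run initBids s).var (by decide))
  refine h.run_of_mem _ fun b hb hbc => ?_
  obtain rfl | rfl : b = vCap ∨ b = vRounds :=
    (by decide : ∀ b ∈ boundVars, b ∈ (Cmd.seq initBids setBounds).vars → b = vCap ∨ b = vRounds)
      b hb hbc
  · rw [run_seq, hcap]
    nlinarith
  · rw [run_seq, hrounds]
    lia

end IsBounded

theorem length_le_inputSize (l : List ℕ) : l.length ≤ inputSize l := by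
  simp [inputSize]

/-- A bound for the numbers of iterations of all loops of `solve c`, in terms of the size of the
input. -/
noncomputable def loopBound : Polynomial ℕ :=
  Polynomial.X ^ 2 * (Polynomial.X ^ 2 + 2) + 2

theorem eval_loopBound (S : ℕ) : loopBound.eval S = S ^ 2 * (S ^ 2 + 2) + 2 := by
  simp [loopBound]

theorem le_eval_loopBound (S : ℕ) : S ≤ loopBound.eval S := by
  rw [eval_loopBound]
  nlinarith [Nat.zero_le (S ^ 2 * S ^ 2)]

theorem events_le_eval_loopBound (X : SiblingInstance) :
    X.feasibleEvents.length * (X.feasibleEvents.length + 2) + 2 ≤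
      loopBound.eval (inputSize X.encode) := by
  have hsize := length_le_inputSize X.encode
  rw [length_encode] at hsize
  have hevents : X.feasibleEvents.length ≤ inputSize X.encode ^ 2 := by
    rw [sq]
    exact X.length_feasibleEvents_le.trans (Nat.mul_le_mul (by lia) (by lia))
  rw [eval_loopBound]
  gcongr

theorem isBounded_run_readSizes (X : SiblingInstance) :
    IsBounded (loopBound.eval (inputSize X.encode)) (readSizes.run (init X.encode)) := by
  have hsize := (length_le_inputSize X.encode).trans (le_eval_loopBound _)
  obtain ⟨hlen, hstudents, hschools, hpairs, hschoolsSucc, hstudentsSucc, -, -⟩ := run_readSizes X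
  have hzero {x : ℕ} (hx : x ∉ readSizes.vars) (hx₀ : x ≠ 0) :
      (readSizes.run (init X.encode)).var x = 0 :=
    ((agreesOff_run readSizes _).var hx).trans (if_neg hx₀)
  simp only [IsBounded, List.forall_mem_cons, hlen, hstudents, hschools, hpairs, hschoolsSucc,
    hstudentsSucc, hzero (x := vEvents) (by decide) (by decide),
    hzero (x := vCap) (by decide) (by decide), hzero (x := vRounds) (by decide) (by decide)]
  rw [length_encode] at hsize ⊢
  exact ⟨by lia, by lia, by lia, by lia, by lia, by lia, zero_le, zero_le, zero_le,
    List.forall_mem_nil _⟩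

theorem isBounded_run_findEvents (X : SiblingInstance) :
    IsBounded (loopBound.eval (inputSize X.encode))
      (findEvents.run (readTables.run (readSizes.run (init X.encode)))) := by
  refine ((isBounded_run_readSizes X).run readTables).run_of_mem findEvents fun b hb hbc => ?_
  obtain rfl : b = vEvents :=
    (by decide : ∀ b ∈ boundVars, b ∈ findEvents.vars → b = vEvents) b hb hbc
  rw [(hasEvents_run_findEvents X).length]
  nlinarith [events_le_eval_loopBound X]

theorem haltsIn_optimize_seq (c : Cmd) (hc : IsStatic c) (h : IsBounded N s)
    (hN : s.var vEvents * (s.var vEvents + 2) + 2 ≤ N) : (Cmd.seq optimize c).HaltsIn N s := by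
  have h₀ := h.run_initBids_setBounds hN
  have h₁ : IsBounded N (runAuction.run s) := h₀.run (.upTo vRound vRounds _)
  have hjoin : (Cmd.seq findGap (.seq initBest joinEvents)).HaltsIn N (runAuction.run s) :=
    h₁.haltsIn _
  exact (((h.haltsIn _).seq (h₀.haltsIn _)).seq hjoin).seq ((h₁.run _).haltsIn c hc)

theorem haltsIn_solve (X : SiblingInstance) (c : Cmd) (hc : IsStatic c) :
    (solve c).HaltsIn (loopBound.eval (inputSize X.encode)) (init X.encode) := by
  have h := isBounded_run_readSizes X
  refine (Cmd.haltsIn readSizes (by decide) _ _ nofun).seq ((h.haltsIn readTables).seq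
    (((h.run readTables).haltsIn findEvents).seq
      (haltsIn_optimize_seq c hc (isBounded_run_findEvents X) ?_)))
  rw [(hasEvents_run_findEvents X).length]
  exact events_le_eval_loopBound X

theorem solvableInPolyTime (c : Cmd) {R : SiblingInstance → List ℕ → Prop}
    (hR : ∀ X s, Loaded X s → X.inst.IsStablePos (best X s) →
      X.IsMaxTogether (X.inst.matchingOf (best X s)) → R X (output (c.run s)))
    (hc : IsStatic c := by decide) : SolvableInPolyTime SiblingInstance.encode R := by
  refine ⟨(solve c).toProg, (solve c).time.comp loopBound, fun X => ?_⟩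
  obtain ⟨t, ht, hexec⟩ := haltsIn_solve X c hc
  obtain ⟨hstable, hmax⟩ := isMaxTogether_optimum X
  exact ⟨_, t, hexec, by rwa [Polynomial.eval_comp], hR X _ (loaded_optimum X) hstable hmax⟩

end RAM

/-- (MSSS) is solvable in polynomial time, and so is the problem of finding a stable matching that
assigns the maximum number of sibling pairs to the same school. -/
theorem mainTheorem4 :
    RAM.SolvableInPolyTime SiblingInstance.encode
      (fun X y => ∃ r, X.IsSameSchoolAnswer r ∧ y = X.encodeAnswer r) ∧
    RAM.SolvableInPolyTime SiblingInstance.encode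
      (fun X y => ∃ M, X.IsMaxTogether M ∧ y = X.encodeMatching M) :=
  ⟨RAM.solvableInPolyTime RAM.outputAnswer fun X s h hstable hmax =>
      ⟨_, hmax.isSameSchoolAnswer, RAM.output_run_outputAnswer h hstable⟩,
    RAM.solvableInPolyTime RAM.outputMatching fun X s h hstable hmax =>
      ⟨_, hmax, RAM.output_run_outputMatching h hstable⟩⟩
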